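/- **Setting.** Let $X,Y,Z$ be real locally convex Hausdorff topological vector spaces with topological duals $X^*,Y^*,Z^*$, and let $\mathcal L(X,Y)$ be the space of continuous linear maps $X\to Y$ with the topology of pointwise convergence. Let $K\subsetneq Y$ be a closed convex cone with $\operatorname{int}K\neq\emptyset$, $S\subset Z$ a nonempty closed convex cone, $\mathcal U\ne\emptyset$ a set and $C\subset X$. Put $Y^\bullet=Y\cup\{-\infty_Y,+\infty_Y\}$, ordered by $y_1<_K y_2\iff y_1-y_2\in-\operatorname{int}K$ for $y_1,y_2\in Y$ and $-\infty_Y<_K y<_K+\infty_Y$ for $y\in Y$, $-\infty_Y<_K+\infty_Y$, with the usual rules $-(\pm\infty_Y)=\mp\infty_Y$, $y+(\pm\infty_Y)=\pm\infty_Y$ for $y \in Y$, $(+\infty_Y)+(+\infty_Y)=+\infty_Y$ and $(-\infty_Y)+(-\infty_Y)=-\infty_Y$; similarly $Z^\bullet$. For $M\subset Y^\bullet$, $\operatorname{WSup}M$ is the set of $\bar v\in Y^\bullet$ such that $\bar v\not<_K v$ for all $v\in M$ and such that for every $\tilde v<_K\bar v$ there is $v\in M$ with $\tilde v<_K v$;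 $\operatorname{WInf}M$ is defined in the same way with the order reversed; $\operatorname{WMax}M=M\cap\operatorname{WSup}M$. For a mapping $F$ from $X$ to $Y^\bullet$ put $\operatorname{dom}F=\{x:F(x)\ne+\infty_Y\}$ and $\operatorname{epi}F=\{(x,y)\in X\times Y:y\in F(x)+K\}$. $F$ is proper if $\operatorname{dom}F\neq\emptyset$ and $F$ never takes the value $-\infty_Y$; it is $K$-convex if $\operatorname{epi}F$ is convex, $K$-epi-closed if $\operatorname{epi}F$ is closed, and positively $K$-lsc if $y^*\circ F$ is lower semicontinuous for every $y^*\in K^+\setminus\{0\}$, where $K^+=\{y^*\in Y^*:\langle y^*,y\rangle\ge0\ \forall y\in K\}$ and $(y^*\circ F)(x)=\pm\infty$ if $F(x)=\pm\infty_Y$. The same notions, with $S$ in place of $K$, are used for mappings into $Z^\bullet$. Put $$F^*(L)=\operatorname{WSup}\{L(x)-F(x):x\in X\},\qquad \operatorname{epi}F^*=\{(L,y)\in\mathcal L(X,Y)\times Y:y\in F^*(L)+K\}.$$ Let $F:X\to Y^\bullet$ and $G_u:X\to Z^\bullet$ ($u\in\mathcal U$) be proper, let $A=C\cap\bigcap_{u\in\mathcal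 U}G_u^{-1}(-S)$, and assume $A\cap\operatorname{dom}F\neq\emptyset$. For $k\in\operatorname{int}K$ and $z^*\in Z^*$ let $(k\cdot z^*)(z)=\langle z^*,z\rangle k$ (similarly $k\cdot x^*$ for $x^*\in X^*$), let $(k\cdot z^*)\circ G_u$ have the value $+\infty_Y$ where $G_u=+\infty_Z$, and let $I_C$ be $0_Y$ on $C$ and $+\infty_Y$ elsewhere. Put $$\mathcal A_k=\bigcup_{(z^*,u)\in S^+\times\mathcal U}\operatorname{epi}\bigl(F+I_C+(k\cdot z^*)\circ G_u\bigr)^*,\qquad E_k=\{(k\cdot x^*,rk):x^*\in X^*,\ r\in\mathbb R\}.$$ A set $N\subset\mathcal L(X,Y)\times Y$ is $k$-sectionally convex if $N\cap(E_k+v)$ is convex for every $v\in\mathcal L(X,Y)\times Y$; $\operatorname{sco}_kN$ is the intersection of all $k$-sectionally convex sets containing $N$. For $\mathcal V\subset\mathcal L(X,Y)$, $\mathcal A_k$ is called *$k$-sectionally convex and closed regarding $\mathcal V\times Y$* if $\operatorname{cl}(\operatorname{sco}_k\mathcal A_k)\cap(\mathcal V\times Y)=\mathcal A_k\cap(\mathcal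 V\times Y)$. For $L\in\mathcal L(X,Y)$ let $$\operatorname{WInf}(\mathrm{RVP}^L)=\operatorname{WInf}\{F(x)-L(x):x\in A\},\quad \operatorname{WMax}(\mathrm{RVD}^{k,L})=\operatorname{WMax}\bigcup_{(z^*,u)\in S^+\times\mathcal U}\operatorname{WInf}\{F(x)-L(x)+((k\cdot z^*)\circ G_u)(x):x\in C\}.$$ *Robust strong $\mathcal V$-stable duality holds for $(\mathrm{RVP})$–$(\mathrm{RVD}^k)$* if $\operatorname{WMax}(\mathrm{RVD}^{k,L})=\operatorname{WInf}(\mathrm{RVP}^L)$ for every $L\in\mathcal V$. **Theorem 6.6 (Principle of convex robust strong $\mathcal V$-stable duality II).** In this setting, assume $(\mathcal H_0)$: $F$ is $K$-convex and positively $K$-lsc, every $G_u$ is $S$-convex and $S$-epi-closed, and $C$ is nonempty, closed and convex. Let $\emptyset\neq\mathcal V\subset\mathcal L(X,Y)$ and $k\in\operatorname{int}K$. Then $\mathcal A_k$ is $k$-sectionally convex and closed regarding $\mathcal V\times Y$ if and only if robust strong $\mathcal V$-stable duality holds for $(\mathrm{RVP})$–$(\mathrm{RVD}^k)$. -/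

import Mathlib

noncomputable section

namespace RobustVector

open Set Topology

/-- The enlarged space `Y ∪ {-∞, +∞}`. -/
inductive Ext (Y : Type*) where
  /-- the smallest element `-∞` -/
  | bot : Ext Y
  /-- an element of the space itself -/
  | fin (y : Y) : Ext Y
  /-- the greatest element `+∞` -/
  | top : Ext Y

namespace Ext

/-- Negation exchanges the two infinite elements. -/
instance {Y : Type*} [Neg Y] : Neg (Ext Y) where
  neg
    | bot => top
    | fin y => fin (-y)
    | top => bot

/-- Addition on `Y ∪ {-∞, +∞}`. The sums of opposite infinities have no meaning in the theory; they
are given the value `+∞` here, and they do not occur for proper mappings. -/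
instance {Y : Type*} [Add Y] : Add (Ext Y) where
  add
    | bot, bot => bot
    | bot, fin _ => bot
    | fin _, bot => bot
    | fin a, fin b => fin (a + b)
    | top, _ => top
    | _, top => top

instance {Y : Type*} [Add Y] [Neg Y] : Sub (Ext Y) where
  sub a b := a + -b

end Ext

section Order

variable {Y : Type*} [AddCommGroup Y] [Module ℝ Y] [TopologicalSpace Y]

/-- The weak ordering: `y₁ <_K y₂` iff `y₁ - y₂ ∈ -int K`, with `-∞ <_K y <_K +∞`. -/
def WLt (K : ProperCone ℝ Y) : Ext Y → Ext Y → Prop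
  | .bot, .bot => False
  | .bot, .fin _ => True
  | .bot, .top => True
  | .fin _, .bot => False
  | .fin y₁, .fin y₂ => y₁ - y₂ ∈ -interior (K : Set Y)
  | .fin _, .top => True
  | .top, _ => False

/-- The weak infimum of a set. (For the empty set this gives `{+∞}`.) -/
def WInf (K : ProperCone ℝ Y) (M : Set (Ext Y)) : Set (Ext Y) :=
  {v | (∀ w ∈ M, ¬ WLt K w v) ∧ ∀ v', WLt K v v' → ∃ w ∈ M, WLt K w v'}

/-- The weak supremum of a set. (For the empty set this gives `{-∞}`.) -/
def WSup (K : ProperCone ℝ Y) (M : Set (Ext Y)) : Set (Ext Y) :=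
  {v | (∀ w ∈ M, ¬ WLt K v w) ∧ ∀ v', WLt K v' v → ∃ w ∈ M, WLt K v' w}

/-- The weak maximum of a set. -/
def WMax (K : ProperCone ℝ Y) (M : Set (Ext Y)) : Set (Ext Y) :=
  M ∩ WSup K M

end Order

section Mappings

variable {X Y Z : Type*}
  [AddCommGroup X] [Module ℝ X] [TopologicalSpace X]
  [AddCommGroup Y] [Module ℝ Y] [TopologicalSpace Y]
  [AddCommGroup Z] [Module ℝ Z] [TopologicalSpace Z]

/-- The effective domain. -/
def dom (F : X → Ext Y) : Set X := {x | F x ≠ Ext.top}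

/-- Proper mappings: the domain is nonempty and `-∞` is not a value. -/
def IsProper (F : X → Ext Y) : Prop := (dom F).Nonempty ∧ ∀ x, F x ≠ Ext.bot

/-- The `K`-epigraph `{(x, y) | y ∈ F x + K}`. -/
def epi (K : ProperCone ℝ Y) (F : X → Ext Y) : Set (X × Y) :=
  {p | ∃ c ∈ K, Ext.fin p.2 = F p.1 + Ext.fin c}

/-- `K`-convexity of a mapping. -/
def IsConeConvex (K : ProperCone ℝ Y) (F : X → Ext Y) : Prop := Convex ℝ (epi K F)

/-- `K`-epi closedness of a mapping. -/
def IsEpiClosed (K : ProperCone ℝ Y) (F : X → Ext Y) : Prop := IsClosed (epi K F)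

/-- The positive dual cone of a cone `S`. -/
def posDual (S : ProperCone ℝ Z) : Set (Z →L[ℝ] ℝ) := {z | ∀ s ∈ S, 0 ≤ z s}

/-- The composition `y* ∘ F` as an extended real function. -/
def scalarize (y : Y →L[ℝ] ℝ) (F : X → Ext Y) (x : X) : EReal :=
  match F x with
  | .bot => ⊥
  | .fin v => ((y v : ℝ) : EReal)
  | .top => ⊤

/-- Positive `K`-lower semicontinuity: `y* ∘ F` is lsc for all nonzero `y*` in the dual cone. -/
def IsPosLsc (K : ProperCone ℝ Y) (F : X → Ext Y) : Prop :=
  ∀ y ∈ posDual K, y ≠ 0 → LowerSemicontinuous (scalarize y F)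

open Classical in
/-- The indicator mapping of a set. -/
def indicatorMap (Y : Type*) [Zero Y] (D : Set X) (x : X) : Ext Y :=
  if x ∈ D then Ext.fin 0 else Ext.top

/-- The composition `T ∘ G` of an operator with an extended mapping; in particular its value is
`+∞` wherever `G` has the value `+∞`. -/
def compMap (T : Z → Y) (G : X → Ext Z) (x : X) : Ext Y :=
  match G x with
  | .bot => .bot
  | .fin z => .fin (T z)
  | .top => .top

/-- The rank one operator `k · z*`, that is `z ↦ ⟨z*, z⟩ k`. -/
def rankOne (k : Y) (z : Z →L[ℝ] ℝ) : Z → Y := fun w => z w • k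

variable [IsTopologicalAddGroup X] [ContinuousSMul ℝ X]
  [IsTopologicalAddGroup Y] [ContinuousSMul ℝ Y]

/-- The conjugate mapping `F*(L) = WSup {L x - F x | x ∈ X}`. -/
def conj (K : ProperCone ℝ Y) (F : X → Ext Y) (L : X →Lₚₜ[ℝ] Y) : Set (Ext Y) :=
  WSup K (range fun x => Ext.fin (L x) - F x)

/-- The `K`-epigraph of the conjugate mapping, `{(L, y) | y ∈ F*(L) + K}`, a subset of
`L(X, Y) × Y`, where `L(X, Y)` has the topology of pointwise convergence. -/
def epiConj (K : ProperCone ℝ Y) (F : X → Ext Y) : Set ((X →Lₚₜ[ℝ] Y) × Y) :=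
  {p | ∃ v ∈ conj K F p.1, ∃ c ∈ K, Ext.fin p.2 = v + Ext.fin c}

/-- The subspace `E_k = {(k · x*, r k) | x* ∈ X*, r ∈ ℝ}` of `L(X, Y) × Y`. -/
def sectionSpace (X : Type*) {Y : Type*}
    [AddCommGroup X] [Module ℝ X] [TopologicalSpace X]
    [AddCommGroup Y] [Module ℝ Y] [TopologicalSpace Y]
    [IsTopologicalAddGroup Y] [ContinuousSMul ℝ Y] (k : Y) :
    Submodule ℝ ((X →Lₚₜ[ℝ] Y) × Y) where
  carrier := {p | ∃ (x' : X →L[ℝ] ℝ) (r : ℝ), (∀ x, p.1 x = rankOne k x' x) ∧ p.2 = r • k}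
  zero_mem' := ⟨0, 0, fun x => by simp [rankOne], by simp⟩
  add_mem' := by
    rintro p q ⟨a, r, h₁, h₂⟩ ⟨b, s, h₃, h₄⟩
    refine ⟨a + b, r + s, fun x => ?_, ?_⟩
    · have h₁x := h₁ x
      have h₃x := h₃ x
      simp only [rankOne] at h₁x h₃x
      simp [rankOne, h₁x, h₃x, add_smul]
    · simp [h₂, h₄, add_smul]
  smul_mem' := by
    rintro c p ⟨a, r, h₁, h₂⟩
    refine ⟨c • a, c * r, fun x => ?_, ?_⟩
    · have h₁x := h₁ x
      simp only [rankOne] at h₁x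
      simp [rankOne, h₁x, mul_smul]
    · simp [h₂, mul_smul]

end Mappings

section Sectional

variable {E : Type*} [AddCommGroup E] [Module ℝ E]

/-- `N` is `E₀`-sectionally convex if `N ∩ (E₀ + v)` is convex for all `v`. -/
def IsSectionallyConvex (E₀ : Submodule ℝ E) (N : Set E) : Prop :=
  ∀ v : E, Convex ℝ (N ∩ ((fun e => e + v) '' (E₀ : Set E)))

/-- The `E₀`-sectionally convex hull. -/
def sectionalHull (E₀ : Submodule ℝ E) (N : Set E) : Set E :=
  ⋂₀ {M | IsSectionallyConvex E₀ M ∧ N ⊆ M}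

/-- `N` is `E₀`-sectionally convex and closed regarding `R` if the closure of its `E₀`-sectionally
convex hull coincides with `N` on `R`. -/
def IsSectionallyConvexClosedRegarding [TopologicalSpace E] (E₀ : Submodule ℝ E) (N R : Set E) :
    Prop :=
  closure (sectionalHull E₀ N) ∩ R = N ∩ R

end Sectional

section Problem

variable {X Y Z U : Type*}
  [AddCommGroup X] [Module ℝ X] [TopologicalSpace X]
  [AddCommGroup Y] [Module ℝ Y] [TopologicalSpace Y]
  [AddCommGroup Z] [Module ℝ Z] [TopologicalSpace Z]

/-- The feasible set `C ∩ ⋂ u, G_u⁻¹(-S)`. -/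
def feasibleSet (S : ProperCone ℝ Z) (C : Set X) (G : U → X → Ext Z) : Set X :=
  C ∩ ⋂ u, {x | ∃ s ∈ S, G u x = Ext.fin (-s)}

/-- The convexity hypothesis on the data of the problem. -/
structure ConvexData (K : ProperCone ℝ Y) (S : ProperCone ℝ Z) (C : Set X) (F : X → Ext Y)
    (G : U → X → Ext Z) : Prop where
  convex_obj : IsConeConvex K F
  lsc_obj : IsPosLsc K F
  convex_constraint : ∀ u, IsConeConvex S (G u)
  closed_constraint : ∀ u, IsEpiClosed S (G u)
  nonempty_set : C.Nonempty
  closed_set : IsClosed C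
  convex_set : Convex ℝ C

variable [IsTopologicalAddGroup Y] [ContinuousSMul ℝ Y]

/-- The qualifying set `⋃ (z*, u), epi (F + I_C + (k · z*) ∘ G_u)*`, over `z*` in the dual cone of
`S` and all `u`. -/
def qualifyingSet (K : ProperCone ℝ Y) (S : ProperCone ℝ Z) (C : Set X) (F : X → Ext Y)
    (G : U → X → Ext Z) (k : Y) : Set ((X →Lₚₜ[ℝ] Y) × Y) :=
  ⋃ z ∈ posDual S, ⋃ u : U,
    epiConj K (fun x => F x + indicatorMap Y C x + compMap (rankOne k z) (G u) x)

/-- The weak infimum of the perturbed primal problem: the weak infimum of the values `F x - L x`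
over the feasible set. -/
def primalWInf (K : ProperCone ℝ Y) (S : ProperCone ℝ Z) (C : Set X) (F : X → Ext Y)
    (G : U → X → Ext Z) (L : X →Lₚₜ[ℝ] Y) : Set (Ext Y) :=
  WInf K ((fun x => F x - Ext.fin (L x)) '' feasibleSet S C G)

/-- The weak maximum of the perturbed dual problem, i.e. of the union over `(z*, u)` of the sets
`WInf {F x - L x + ⟨z*, G_u x⟩ k | x ∈ C}`. -/
def dualWMax (K : ProperCone ℝ Y) (S : ProperCone ℝ Z) (C : Set X) (F : X → Ext Y)
    (G : U → X → Ext Z) (k : Y) (L : X →Lₚₜ[ℝ] Y) : Set (Ext Y) :=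
  WMax K (⋃ z ∈ posDual S, ⋃ u : U,
    WInf K ((fun x => F x - Ext.fin (L x) + compMap (rankOne k z) (G u) x) '' C))

/-- Robust strong `V`-stable duality: for every `L` in `V`, the weak maximum of the perturbed dual
problem equals the weak infimum of the perturbed primal problem. -/
def RobustStrongStableDuality (K : ProperCone ℝ Y) (S : ProperCone ℝ Z) (C : Set X)
    (F : X → Ext Y) (G : U → X → Ext Z) (k : Y) (V : Set (X →Lₚₜ[ℝ] Y)) : Prop :=
  ∀ L ∈ V, dualWMax K S C F G k L = primalWInf K S C F G L

end Problem

end RobustVector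

end

set_option linter.unusedSectionVars false

namespace RobustVector

open Set Topology

/-! ### Interior of the cone; finite weak infima and suprema as boundary points. -/

section Cone

variable {Y : Type*} [AddCommGroup Y] [Module ℝ Y] [TopologicalSpace Y]
  [IsTopologicalAddGroup Y] [ContinuousSMul ℝ Y] {K : ProperCone ℝ Y}

/-! Both sides of the equivalence compare `qualifyingSet` with one larger set, `primalEpiConj`: the
pairs `(L, y)` such that `-y` is a weak lower bound of `F - L` on the feasible set.

On the duality side, a weak lower bound can be raised along `k` until it becomes a finite weak
infimum. Strong duality at `L` therefore says that every primal weak lower bound is one for some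
single multiplier pair `(z, u)` (`wMax_iUnion_wInf_eq_wInf_iff`, `dualWMax_eq_primalWInf_iff`), i.e.
that the two sets agree over `L`.

On the other side, `closure_sectionalHull_qualifyingSet` identifies the closed sectionally convex
hull of `qualifyingSet` with `primalEpiConj`. One inclusion is weak duality, because `primalEpiConj`
is closed and `k`-sectionally convex. For the other, Hahn-Banach turns the weak lower bound into a
scalar one, through `f` in the dual cone with `f k = 1`. A Farkas lemma puts `(f ∘ L, f y)` in the
weak* closed convex hull of scalar minorants with multipliers, and `sectionMap`, affine and
continuous into the section through `(L, y)`, carries this hull into the required closure. -/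

theorem interior_add_mem {d c : Y} (hd : d ∈ interior (K : Set Y)) (hc : c ∈ K) :
    d + c ∈ interior (K : Set Y) := by
  have hsub : (fun y => y + c) '' interior (K : Set Y) ⊆ K := by
    rintro _ ⟨y, hy, rfl⟩
    exact K.add_mem (interior_subset hy) hc
  exact interior_maximal hsub ((Homeomorph.addRight c).isOpenMap _ isOpen_interior)
    (mem_image_of_mem _ hd)

theorem smul_mem_interior {d : Y} (hd : d ∈ interior (K : Set Y)) {t : ℝ} (ht : 0 < t) :
    t • d ∈ interior (K : Set Y) := by
  have hsub : (fun y => t • y) '' interior (K : Set Y) ⊆ K := by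
    rintro _ ⟨y, hy, rfl⟩
    exact K.smul_mem (interior_subset hy) ht.le
  exact interior_maximal hsub ((Homeomorph.smulOfNeZero t ht.ne').isOpenMap _ isOpen_interior)
    (mem_image_of_mem _ hd)

theorem exists_sub_smul_mem_interior {d : Y} (hd : d ∈ interior (K : Set Y)) (y : Y) :
    ∃ ε > 0, d - (ε : ℝ) • y ∈ interior (K : Set Y) := by
  have hcont : Continuous fun ε : ℝ => d - ε • y := by fun_prop
  have hmem : ∀ᶠ ε : ℝ in 𝓝 0, d - ε • y ∈ interior (K : Set Y) :=
    hcont.continuousAt.eventually_mem (by simpa using isOpen_interior.mem_nhds hd)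
  obtain ⟨ε, hε, h⟩ := ((hmem.filter_mono nhdsWithin_le_nhds).and
    (self_mem_nhdsWithin : Ioi (0 : ℝ) ∈ 𝓝[>] 0)).exists
  exact ⟨ε, h, hε⟩

/-- If `f y > 0`, then `d - ε y ∈ K` for small `ε > 0`, whence `f d ≥ ε f y > 0`. -/
theorem pos_of_mem_interior {f : Y →L[ℝ] ℝ} (hf : f ∈ posDual K) (hf0 : f ≠ 0) {d : Y}
    (hd : d ∈ interior (K : Set Y)) : 0 < f d := by
  obtain ⟨y, hy⟩ : ∃ y, 0 < f y := by
    by_contra! h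
    exact hf0 (ContinuousLinearMap.ext fun y => le_antisymm (h y) (by simpa using h (-y)))
  obtain ⟨ε, hε, h⟩ := exists_sub_smul_mem_interior hd y
  have := hf _ (interior_subset h)
  simp only [map_sub, map_smul, smul_eq_mul] at this
  nlinarith [mul_pos hε hy]

/-- The set `A + int K`. -/
def strictUpper (K : ProperCone ℝ Y) (A : Set Y) : Set Y :=
  {y | ∃ a ∈ A, y - a ∈ interior (K : Set Y)}

theorem strictUpper_add_mem {A : Set Y} {y c : Y} (hy : y ∈ strictUpper K A) (hc : c ∈ K) :
    y + c ∈ strictUpper K A := by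
  obtain ⟨a, ha, h⟩ := hy
  refine ⟨a, ha, ?_⟩
  rw [add_sub_right_comm]
  exact interior_add_mem h hc

theorem isOpen_strictUpper (A : Set Y) : IsOpen (strictUpper K A) := by
  have : strictUpper K A = ⋃ a ∈ A, (fun y => y - a) ⁻¹' interior (K : Set Y) := by
    ext; simp [strictUpper]
  rw [this]
  exact isOpen_biUnion fun a _ => isOpen_interior.preimage (by fun_prop)

/-- The set of `t` for which `y + t k` stays outside `A + int K` is closed, and it is bounded
because `k` is interior; its largest element gives the boundary point. This is how a lower bound is
raised to a finite weak infimum. -/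
theorem exists_nonneg_smul_add_notMem_strictUpper {A : Set Y} (hA : A.Nonempty) {y k : Y}
    (hk : k ∈ interior (K : Set Y)) (hy : y ∉ strictUpper K A) :
    ∃ t : ℝ, 0 ≤ t ∧ y + t • k ∉ strictUpper K A ∧
      ∀ d ∈ interior (K : Set Y), y + t • k + d ∈ strictUpper K A := by
  have hkK : k ∈ K := interior_subset hk
  have mono : ∀ {s t : ℝ}, s ≤ t → y + s • k ∈ strictUpper K A →
      y + t • k ∈ strictUpper K A := by
    intro s t hst h
    have := strictUpper_add_mem h (K.smul_mem hkK (sub_nonneg.2 hst))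
    rwa [add_assoc, ← add_smul, add_sub_cancel] at this
  set T : Set ℝ := {t | y + t • k ∉ strictUpper K A} with hT
  obtain ⟨a, ha⟩ := hA
  have hbdd : BddAbove T := by
    -- Dividing `k - ε (a - y)` by `ε` gives `y + ε⁻¹ k - a ∈ int K`, so `ε⁻¹` bounds the ray.
    obtain ⟨ε, hε, h⟩ := exists_sub_smul_mem_interior hk (a - y)
    refine ⟨ε⁻¹, fun t ht => le_of_not_gt fun hlt => ht (mono hlt.le ⟨a, ha, ?_⟩)⟩
    have := smul_mem_interior h (inv_pos.2 hε)
    rw [smul_sub, inv_smul_smul₀ hε.ne'] at this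
    convert this using 1
    abel
  have h0 : (0 : ℝ) ∈ T := by simpa [hT] using hy
  have hclosed : IsClosed T :=
    ((isOpen_strictUpper A).preimage (f := fun t : ℝ => y + t • k) (by fun_prop)).isClosed_compl
  refine ⟨sSup T, le_csSup hbdd h0, hclosed.csSup_mem ⟨0, h0⟩ hbdd, fun d hd => ?_⟩
  -- Write `d` as `ε k` plus an interior remainder: the first part passes the supremum, the second
  -- keeps the point inside.
  obtain ⟨ε, hε, h⟩ := exists_sub_smul_mem_interior hd k
  have hmem : y + (sSup T + ε) • k ∈ strictUpper K A := by
    by_contra hcon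
    linarith [le_csSup hbdd (show sSup T + ε ∈ T from hcon)]
  have := strictUpper_add_mem hmem (interior_subset h)
  convert this using 1
  rw [add_smul]
  abel

theorem wLt_fin {a b : Y} :
    WLt K (Ext.fin a) (Ext.fin b) ↔ b - a ∈ interior (K : Set Y) := by
  simp [WLt]

theorem not_wLt_bot (v : Ext Y) : ¬ WLt K v .bot := by
  cases v <;> simp [WLt]

section WInf

variable {M : Set (Ext Y)}

/-- Only finite members matter: `+∞` lies strictly below nothing and `-∞` is excluded. The finite
member supplied by `hne` handles the comparison with `+∞`. -/
theorem fin_mem_wInf (hne : ∃ m, Ext.fin m ∈ M) (hbot : Ext.bot ∉ M) {y : Y} :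
    Ext.fin y ∈ WInf K M ↔ y ∉ strictUpper K {m | Ext.fin m ∈ M} ∧
      ∀ d ∈ interior (K : Set Y), y + d ∈ strictUpper K {m | Ext.fin m ∈ M} := by
  constructor
  · rintro ⟨h₁, h₂⟩
    refine ⟨?_, fun d hd => ?_⟩
    · rintro ⟨a, ha, h⟩
      exact h₁ _ ha (wLt_fin.2 h)
    · obtain ⟨w, hw, hlt⟩ := h₂ (.fin (y + d)) (wLt_fin.2 (by simpa using hd))
      cases w with
      | bot => exact absurd hw hbot
      | fin a => exact ⟨a, hw, wLt_fin.1 hlt⟩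
      | top => exact hlt.elim
  · rintro ⟨h₁, h₂⟩
    refine ⟨fun w hw hlt => ?_, fun v hv => ?_⟩
    · cases w with
      | bot => exact hbot hw
      | fin a => exact h₁ ⟨a, hw, wLt_fin.1 hlt⟩
      | top => exact hlt
    · cases v with
      | bot => exact hv.elim
      | fin b =>
        obtain ⟨a, ha, h⟩ := h₂ (b - y) (wLt_fin.1 hv)
        exact ⟨.fin a, ha, wLt_fin.2 (by simpa using h)⟩
      | top =>
        obtain ⟨m, hm⟩ := hne
        exact ⟨.fin m, hm, trivial⟩

theorem bot_mem_wInf (hne : ∃ m, Ext.fin m ∈ M) (hbot : Ext.bot ∉ M) :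
    Ext.bot ∈ WInf K M ↔ ∀ y, y ∈ strictUpper K {m | Ext.fin m ∈ M} := by
  constructor
  · rintro ⟨-, h⟩ y
    obtain ⟨w, hw, hlt⟩ := h (.fin y) trivial
    cases w with
    | bot => exact absurd hw hbot
    | fin a => exact ⟨a, hw, wLt_fin.1 hlt⟩
    | top => exact hlt.elim
  · intro h
    refine ⟨fun w _ => not_wLt_bot w, fun v hv => ?_⟩
    cases v with
    | bot => exact hv.elim
    | fin b =>
      obtain ⟨a, ha, h⟩ := h b
      exact ⟨.fin a, ha, wLt_fin.2 h⟩
    | top =>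
      obtain ⟨m, hm⟩ := hne
      exact ⟨.fin m, hm, trivial⟩

theorem top_notMem_wInf (hne : ∃ m, Ext.fin m ∈ M) : Ext.top ∉ WInf K M := by
  obtain ⟨m, hm⟩ := hne
  exact fun h => h.1 _ hm trivial

end WInf

/-- Negation reverses the order, so suprema are also described by `strictUpper`. -/
theorem fin_mem_wSup {N : Set (Ext Y)} (hne : ∃ m, Ext.fin m ∈ N) (htop : Ext.top ∉ N) {y : Y} :
    Ext.fin y ∈ WSup K N ↔ -y ∉ strictUpper K {m | Ext.fin (-m) ∈ N} ∧
      ∀ d ∈ interior (K : Set Y), -y + d ∈ strictUpper K {m | Ext.fin (-m) ∈ N} := by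
  constructor
  · rintro ⟨h₁, h₂⟩
    refine ⟨?_, fun d hd => ?_⟩
    · rintro ⟨a, ha, h⟩
      exact h₁ _ ha (wLt_fin.2 (by convert h using 1; abel))
    · obtain ⟨w, hw, hlt⟩ := h₂ (.fin (y - d)) (wLt_fin.2 (by simpa using hd))
      cases w with
      | bot => exact hlt.elim
      | fin a => exact ⟨-a, by simpa using hw, by convert wLt_fin.1 hlt using 1; abel⟩
      | top => exact absurd hw htop
  · rintro ⟨h₁, h₂⟩
    refine ⟨fun w hw hlt => ?_, fun v hv => ?_⟩
    · cases w with
      | bot => exact hlt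
      | fin a => exact h₁ ⟨-a, by simpa using hw, by convert wLt_fin.1 hlt using 1; abel⟩
      | top => exact htop hw
    · cases v with
      | bot =>
        obtain ⟨m, hm⟩ := hne
        exact ⟨.fin m, hm, trivial⟩
      | fin b =>
        obtain ⟨a, ha, h⟩ := h₂ (y - b) (wLt_fin.1 hv)
        exact ⟨.fin (-a), ha, wLt_fin.2 (by convert h using 1; abel)⟩
      | top => exact hv.elim

end Cone

/-! ### Arithmetic with infinite values. -/

section ExtArithmetic

variable {Y : Type*}

theorem Ext.fin_add_fin [Add Y] (a b : Y) : Ext.fin a + Ext.fin b = Ext.fin (a + b) := rfl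

theorem Ext.bot_add_fin [Add Y] (b : Y) : Ext.bot + Ext.fin b = Ext.bot := rfl

theorem Ext.top_add [Add Y] (v : Ext Y) : Ext.top + v = Ext.top := rfl

theorem Ext.add_top [Add Y] (v : Ext Y) : v + Ext.top = Ext.top := by cases v <;> rfl

theorem Ext.fin_sub_fin [AddGroup Y] (a b : Y) : Ext.fin a - Ext.fin b = Ext.fin (a - b) := by
  rw [sub_eq_add_neg a b]; rfl

theorem Ext.fin_sub_top [AddGroup Y] (a : Y) : Ext.fin a - Ext.top = Ext.bot := rfl

theorem Ext.top_sub [AddGroup Y] (v : Ext Y) : Ext.top - v = Ext.top := rfl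

end ExtArithmetic

/-! ### Weak maxima of families of weak infima. -/

section WMax

variable {Y : Type*} [AddCommGroup Y] [Module ℝ Y] [TopologicalSpace Y]
  [IsTopologicalAddGroup Y] [ContinuousSMul ℝ Y] {K : ProperCone ℝ Y}

/-- The approximation clause of `WSup` is automatic for a member of `D`, which is its own witness.
-/
theorem mem_wMax {D : Set (Ext Y)} {d : Ext Y} :
    d ∈ WMax K D ↔ d ∈ D ∧ ∀ w ∈ D, ¬ WLt K d w :=
  ⟨fun h => ⟨h.1, h.2.1⟩, fun h => ⟨h.1, h.2, fun _ hv => ⟨d, h.1, hv⟩⟩⟩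

/-- For a family of sets of values dominated by a set `M₀`, the weak maximum of the weak infima
agrees with the weak infimum of `M₀` iff every lower bound of `M₀` is a lower bound of some member
of the family. -/
theorem wMax_iUnion_wInf_eq_wInf_iff {ι : Type*} [Nonempty ι] {k : Y}
    (hk : k ∈ interior (K : Set Y)) {M : ι → Set (Ext Y)} {M₀ : Set (Ext Y)}
    (hne : ∀ i, ∃ m, Ext.fin m ∈ M i) (hbot : ∀ i, Ext.bot ∉ M i)
    (hne₀ : ∃ m, Ext.fin m ∈ M₀) (hbot₀ : Ext.bot ∉ M₀)
    (hle : ∀ i, strictUpper K {m | Ext.fin m ∈ M₀} ⊆ strictUpper K {m | Ext.fin m ∈ M i}) :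
    WMax K (⋃ i, WInf K (M i)) = WInf K M₀ ↔
      ∀ y ∉ strictUpper K {m | Ext.fin m ∈ M₀},
        ∃ i, y ∉ strictUpper K {m | Ext.fin m ∈ M i} := by
  have add_ray : ∀ {A : Set Y} {y : Y} {t : ℝ}, 0 ≤ t → y + t • k ∉ strictUpper K A →
      y ∉ strictUpper K A := fun ht h hy =>
    h (strictUpper_add_mem hy (K.smul_mem (interior_subset hk) ht))
  constructor
  · intro h y hy
    obtain ⟨t, ht, h₁, h₂⟩ := exists_nonneg_smul_add_notMem_strictUpper (K := K) hne₀ hk hy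
    have hmem := (fin_mem_wInf hne₀ hbot₀).2 ⟨h₁, h₂⟩
    rw [← h] at hmem
    obtain ⟨i, hi⟩ := mem_iUnion.1 hmem.1
    exact ⟨i, add_ray ht ((fin_mem_wInf (hne i) (hbot i)).1 hi).1⟩
  · intro h
    ext d
    rw [mem_wMax]
    cases d with
    | top =>
      refine iff_of_false (fun hd => ?_) (top_notMem_wInf hne₀)
      obtain ⟨i, hi⟩ := mem_iUnion.1 hd.1
      exact top_notMem_wInf (hne i) hi
    | bot =>
      rw [bot_mem_wInf hne₀ hbot₀]
      constructor
      · rintro ⟨-, hmax⟩ y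
        by_contra hy
        obtain ⟨i, hi⟩ := h y hy
        obtain ⟨t, -, h₁, h₂⟩ := exists_nonneg_smul_add_notMem_strictUpper (K := K) (hne i) hk hi
        exact hmax _ (mem_iUnion.2 ⟨i, (fin_mem_wInf (hne i) (hbot i)).2 ⟨h₁, h₂⟩⟩) trivial
      · intro hall
        have hall' : ∀ i y, y ∈ strictUpper K {m | Ext.fin m ∈ M i} := fun i y => hle i (hall y)
        refine ⟨mem_iUnion.2 ⟨Classical.arbitrary ι,
          (bot_mem_wInf (hne _) (hbot _)).2 (hall' _)⟩, fun w hw hlt => ?_⟩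
        obtain ⟨i, hi⟩ := mem_iUnion.1 hw
        cases w with
        | bot => exact hlt
        | fin y => exact ((fin_mem_wInf (hne i) (hbot i)).1 hi).1 (hall' i y)
        | top => exact top_notMem_wInf (hne i) hi
    | fin y =>
      rw [fin_mem_wInf hne₀ hbot₀]
      constructor
      · rintro ⟨hD, hmax⟩
        obtain ⟨i, hi⟩ := mem_iUnion.1 hD
        refine ⟨fun hy => ((fin_mem_wInf (hne i) (hbot i)).1 hi).1 (hle i hy), fun c hc => ?_⟩
        -- Otherwise `y + c` is a lower bound of some `M j`; raising it along `k` gives a member of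
        -- the union strictly above `y`.
        by_contra hcon
        obtain ⟨j, hj⟩ := h _ hcon
        obtain ⟨t, ht, h₁, h₂⟩ := exists_nonneg_smul_add_notMem_strictUpper (K := K) (hne j) hk hj
        refine hmax _ (mem_iUnion.2 ⟨j, (fin_mem_wInf (hne j) (hbot j)).2 ⟨h₁, h₂⟩⟩)
          (wLt_fin.2 ?_)
        have := interior_add_mem hc (K.smul_mem (interior_subset hk) ht)
        convert this using 1
        abel
      · rintro ⟨hy, hupper⟩
        obtain ⟨i, hi⟩ := h y hy
        obtain ⟨t, ht, h₁, h₂⟩ := exists_nonneg_smul_add_notMem_strictUpper (K := K) (hne i) hk hi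
        -- For `t > 0`, `hupper` would put `y + t k` strictly above a value of `M₀`, hence of `M i`.
        have ht0 : t = 0 := by
          by_contra hne
          exact h₁ (hle i (hupper _ (smul_mem_interior hk (lt_of_le_of_ne ht (Ne.symm hne)))))
        subst ht0
        rw [zero_smul, add_zero] at h₁ h₂
        refine ⟨mem_iUnion.2 ⟨i, (fin_mem_wInf (hne i) (hbot i)).2 ⟨h₁, h₂⟩⟩, fun w hw hlt => ?_⟩
        obtain ⟨j, hj⟩ := mem_iUnion.1 hw
        cases w with
        | bot => exact hlt
        | fin b =>
          have hb := hupper _ (wLt_fin.1 hlt)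
          rw [add_sub_cancel] at hb
          exact ((fin_mem_wInf (hne j) (hbot j)).1 hj).1 (hle j hb)
        | top => exact top_notMem_wInf (hne j) hj

end WMax

/-! ### Epigraphs of conjugates as sets of weak lower bounds. -/

section Conjugate

variable {X Y : Type*}
  [AddCommGroup X] [Module ℝ X] [TopologicalSpace X] [IsTopologicalAddGroup X] [ContinuousSMul ℝ X]
  [AddCommGroup Y] [Module ℝ Y] [TopologicalSpace Y]
  [IsTopologicalAddGroup Y] [ContinuousSMul ℝ Y] {K : ProperCone ℝ Y}

/-- The conjugate is the negated weak infimum of `H - L`. Raising `-y` along `k` reaches a finite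
weak infimum, and the displacement `t k ∈ K` is the slack in the epigraph. -/
theorem mem_epiConj {H : X → Ext Y} (hne : ∃ x v, H x = Ext.fin v) (hbot : ∀ x, H x ≠ Ext.bot)
    {k : Y} (hk : k ∈ interior (K : Set Y)) {L : X →Lₚₜ[ℝ] Y} {y : Y} :
    (L, y) ∈ epiConj K H ↔ -y ∉ strictUpper K {m | ∃ x v, H x = Ext.fin v ∧ m = v - L x} := by
  have hset : {m | Ext.fin (-m) ∈ range fun x => Ext.fin (L x) - H x} =
      {m | ∃ x v, H x = Ext.fin v ∧ m = v - L x} := by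
    ext m
    constructor
    · rintro ⟨x, hx⟩
      rcases hv : H x with _ | v | _
      · exact absurd hv (hbot x)
      · simp only [hv, Ext.fin_sub_fin, Ext.fin.injEq] at hx
        exact ⟨x, v, hv, by rw [← neg_eq_iff_eq_neg.2 hx]; abel⟩
      · simp [hv, Ext.fin_sub_top] at hx
    · rintro ⟨x, v, hv, rfl⟩
      exact ⟨x, by simp [hv, Ext.fin_sub_fin]⟩
  have htop : Ext.top ∉ range fun x => Ext.fin (L x) - H x := by
    rintro ⟨x, hx⟩
    rcases hv : H x with _ | v | _
    · exact absurd hv (hbot x)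
    · simp [hv, Ext.fin_sub_fin] at hx
    · simp [hv, Ext.fin_sub_top] at hx
  obtain ⟨x₀, v₀, hv₀⟩ := hne
  have hfin : ∃ m, Ext.fin m ∈ range fun x => Ext.fin (L x) - H x :=
    ⟨L x₀ - v₀, x₀, by simp [hv₀, Ext.fin_sub_fin]⟩
  rw [← hset]
  constructor
  · rintro ⟨v, hv, c, hc, hyc⟩ hy
    cases v with
    | bot => simp [Ext.bot_add_fin] at hyc
    | top => exact htop.elim (by simp [Ext.top_add] at hyc)
    | fin a =>
      simp only [Ext.fin_add_fin, Ext.fin.injEq] at hyc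
      refine ((fin_mem_wSup hfin htop).1 hv).1 ?_
      convert strictUpper_add_mem hy hc using 1
      rw [hyc]
      abel
  · intro hy
    obtain ⟨t, ht, h₁, h₂⟩ := exists_nonneg_smul_add_notMem_strictUpper (K := K)
      (A := {m | Ext.fin (-m) ∈ range fun x => Ext.fin (L x) - H x})
      ⟨v₀ - L x₀, by rw [hset]; exact ⟨x₀, v₀, hv₀, rfl⟩⟩ hk hy
    refine ⟨Ext.fin (y - t • k), (fin_mem_wSup hfin htop).2 ?_, t • k,
      K.smul_mem (interior_subset hk) ht, by simp [Ext.fin_add_fin]⟩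
    rw [show -(y - t • k) = -y + t • k by abel]
    exact ⟨h₁, h₂⟩

end Conjugate

/-! ### Finite primal and dual values, and weak duality. -/

section Values

variable {X Y Z U : Type*}
  [AddCommGroup X] [Module ℝ X] [TopologicalSpace X]
  [AddCommGroup Y] [Module ℝ Y] [TopologicalSpace Y]
  [IsTopologicalAddGroup Y] [ContinuousSMul ℝ Y]
  [AddCommGroup Z] [Module ℝ Z] [TopologicalSpace Z]

/-- The finite values `F x - L x` over the feasible set. -/
def primalValues (S : ProperCone ℝ Z) (C : Set X) (F : X → Ext Y) (G : U → X → Ext Z)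
    (L : X →Lₚₜ[ℝ] Y) : Set Y :=
  {m | ∃ x ∈ feasibleSet S C G, ∃ v, F x = Ext.fin v ∧ m = v - L x}

/-- The finite values `F x - L x + ⟨z, g x⟩ k` over `C`. -/
def dualValues (C : Set X) (F : X → Ext Y) (g : X → Ext Z) (k : Y) (L : X →Lₚₜ[ℝ] Y)
    (z : Z →L[ℝ] ℝ) : Set Y :=
  {m | ∃ x ∈ C, ∃ v w, F x = Ext.fin v ∧ g x = Ext.fin w ∧ m = v - L x + z w • k}

variable {K : ProperCone ℝ Y} {S : ProperCone ℝ Z} {C : Set X} {F : X → Ext Y}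
  {G : U → X → Ext Z} {g : X → Ext Z} {k : Y} {L : X →Lₚₜ[ℝ] Y} {z : Z →L[ℝ] ℝ}

/-- Weak duality: at a feasible point `G u x = -s`, so the multiplier term `-(z s) k` lies in `-K`
and only lowers the value. -/
theorem strictUpper_primalValues_subset (hk : k ∈ K) (hz : z ∈ posDual S) (u : U) :
    strictUpper K (primalValues S C F G L) ⊆ strictUpper K (dualValues C F (G u) k L z) := by
  rintro y ⟨_, ⟨x, hx, v, hv, rfl⟩, hy⟩
  obtain ⟨s, hs, hGs⟩ := mem_iInter.1 hx.2 u
  refine ⟨_, ⟨x, hx.1, v, -s, hv, hGs, rfl⟩, ?_⟩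
  convert interior_add_mem hy (K.smul_mem hk (hz s hs)) using 1
  rw [map_neg, neg_smul]
  abel

theorem setOf_fin_mem_primal_image (hF : ∀ x, F x ≠ Ext.bot) :
    {m | Ext.fin m ∈ (fun x => F x - Ext.fin (L x)) '' feasibleSet S C G} =
      primalValues S C F G L := by
  ext m
  constructor
  · rintro ⟨x, hx, hm⟩
    rcases hv : F x with _ | v | _
    · exact absurd hv (hF x)
    · simp only [hv, Ext.fin_sub_fin, Ext.fin.injEq] at hm
      exact ⟨x, hx, v, hv, hm.symm⟩
    · simp [hv, Ext.top_sub] at hm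
  · rintro ⟨x, hx, v, hv, rfl⟩
    exact ⟨x, hx, by simp [hv, Ext.fin_sub_fin]⟩

theorem bot_notMem_primal_image (hF : ∀ x, F x ≠ Ext.bot) :
    Ext.bot ∉ (fun x => F x - Ext.fin (L x)) '' feasibleSet S C G := by
  rintro ⟨x, hx, hm⟩
  rcases hv : F x with _ | v | _
  · exact hF x hv
  · simp [hv, Ext.fin_sub_fin] at hm
  · simp [hv, Ext.top_sub] at hm

theorem setOf_fin_mem_dual_image (hF : ∀ x, F x ≠ Ext.bot) (hg : ∀ x, g x ≠ Ext.bot) :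
    {m | Ext.fin m ∈ (fun x => F x - Ext.fin (L x) + compMap (rankOne k z) g x) '' C} =
      dualValues C F g k L z := by
  ext m
  constructor
  · rintro ⟨x, hx, hm⟩
    rcases hv : F x with _ | v | _
    · exact absurd hv (hF x)
    · rcases hw : g x with _ | w | _
      · exact absurd hw (hg x)
      · simp only [compMap, hw, hv, Ext.fin_sub_fin, Ext.fin_add_fin, Ext.fin.injEq] at hm
        exact ⟨x, hx, v, w, hv, hw, hm.symm⟩
      · simp [compMap, hw, Ext.add_top] at hm
    · simp [hv, Ext.top_sub, Ext.top_add] at hm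
  · rintro ⟨x, hx, v, w, hv, hw, rfl⟩
    exact ⟨x, hx, by simp [compMap, rankOne, hv, hw, Ext.fin_sub_fin, Ext.fin_add_fin]⟩

theorem bot_notMem_dual_image (hF : ∀ x, F x ≠ Ext.bot) (hg : ∀ x, g x ≠ Ext.bot) :
    Ext.bot ∉ (fun x => F x - Ext.fin (L x) + compMap (rankOne k z) g x) '' C := by
  rintro ⟨x, hx, hm⟩
  rcases hv : F x with _ | v | _
  · exact hF x hv
  · rcases hw : g x with _ | w | _
    · exact hg x hw
    · simp [compMap, hw, hv, Ext.fin_sub_fin, Ext.fin_add_fin] at hm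
    · simp [compMap, hw, Ext.add_top] at hm
  · simp [hv, Ext.top_sub, Ext.top_add] at hm

variable [IsTopologicalAddGroup X] [ContinuousSMul ℝ X]

theorem mem_epiConj_lagrangian (hF : ∀ x, F x ≠ Ext.bot) (hg : ∀ x, g x ≠ Ext.bot)
    (hne : ∃ x ∈ C, ∃ v w, F x = Ext.fin v ∧ g x = Ext.fin w)
    (hk : k ∈ interior (K : Set Y)) {y : Y} :
    (L, y) ∈ epiConj K (fun x => F x + indicatorMap Y C x + compMap (rankOne k z) g x) ↔
      -y ∉ strictUpper K (dualValues C F g k L z) := by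
  have hcases : ∀ x, (F x + indicatorMap Y C x + compMap (rankOne k z) g x = Ext.top) ∨
      ∃ v w, x ∈ C ∧ F x = Ext.fin v ∧ g x = Ext.fin w ∧
        F x + indicatorMap Y C x + compMap (rankOne k z) g x = Ext.fin (v + z w • k) := by
    intro x
    by_cases hx : x ∈ C
    · rcases hv : F x with _ | v | _
      · exact absurd hv (hF x)
      · rcases hw : g x with _ | w | _
        · exact absurd hw (hg x)
        · right
          exact ⟨v, w, hx, rfl, rfl, by
            simp [indicatorMap, hx, compMap, rankOne, hw, Ext.fin_add_fin]⟩
        · simp [compMap, hw, Ext.add_top]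
      · simp [Ext.top_add]
    · simp [indicatorMap, hx, Ext.top_add, Ext.add_top]
  rw [mem_epiConj _ _ hk]
  · have : {m | ∃ x v, F x + indicatorMap Y C x + compMap (rankOne k z) g x = Ext.fin v ∧
        m = v - L x} = dualValues C F g k L z := by
      ext m
      constructor
      · rintro ⟨x, a, ha, rfl⟩
        rcases hcases x with h | ⟨v, w, hx, hv, hw, h⟩
        · simp [h] at ha
        · rw [h, Ext.fin.injEq] at ha
          exact ⟨x, hx, v, w, hv, hw, by rw [← ha]; abel⟩
      · rintro ⟨x, hx, v, w, hv, hw, rfl⟩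
        refine ⟨x, v + z w • k, ?_, by abel⟩
        simp [indicatorMap, hx, compMap, rankOne, hv, hw, Ext.fin_add_fin]
    rw [this]
  · obtain ⟨x, hx, v, w, hv, hw⟩ := hne
    refine ⟨x, v + z w • k, ?_⟩
    simp [indicatorMap, hx, compMap, rankOne, hv, hw, Ext.fin_add_fin]
  · intro x
    rcases hcases x with h | ⟨v, w, -, -, -, h⟩ <;> simp [h]

end Values

/-! ### Separation and an approximate Farkas lemma. -/

section Separation

variable {X Z : Type*}
  [AddCommGroup X] [Module ℝ X] [TopologicalSpace X]
  [AddCommGroup Z] [Module ℝ Z] [TopologicalSpace Z]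

/-- The duality pairing between `X* × ℝ` and `X × ℝ`. -/
def dualPairing (X : Type*) [AddCommGroup X] [Module ℝ X] [TopologicalSpace X] :
    ((X →L[ℝ] ℝ) × ℝ) →ₗ[ℝ] (X × ℝ) →ₗ[ℝ] ℝ :=
  LinearMap.mk₂ ℝ (fun q a => q.1 a.1 + q.2 * a.2)
    (fun p q a => by simp; ring) (fun c p a => by simp; ring)
    (fun p a b => by simp; ring) (fun c p a => by simp; ring)

theorem dualPairing_apply (q : (X →L[ℝ] ℝ) × ℝ) (a : X × ℝ) :
    dualPairing X q a = q.1 a.1 + q.2 * a.2 := rfl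

/-- Continuous functionals for the weak topology of the pairing are exactly evaluations at points of
`X × ℝ`, so Hahn-Banach only tests against those. -/
theorem mem_closure_convexHull_of_forall_dualPairing_le {N : Set (WeakBilin (dualPairing X))}
    {p : WeakBilin (dualPairing X)}
    (h : ∀ (a : X × ℝ) (s : ℝ), (∀ q ∈ N, dualPairing X q a ≤ s) → dualPairing X p a ≤ s) :
    p ∈ closure (convexHull ℝ N) := by
  by_contra hp
  obtain ⟨f, s, hN, hs⟩ := geometric_hahn_banach_closed_point
    (convex_convexHull ℝ N).closure isClosed_closure hp
  obtain ⟨a, rfl⟩ := LinearMap.dualEmbedding_surjective (dualPairing X) f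
  exact absurd (h a s fun q hq => (hN q (subset_closure (subset_convexHull ℝ N hq))).le)
    (not_le.2 hs)

variable [IsTopologicalAddGroup X] [ContinuousSMul ℝ X] [LocallyConvexSpace ℝ X]
  [IsTopologicalAddGroup Z] [ContinuousSMul ℝ Z] [LocallyConvexSpace ℝ Z]
  {S : ProperCone ℝ Z} {D : Set (X × Z × ℝ)}

/-- A functional bounded above on `D` cannot increase along the directions `S` and `ℝ₊`, under which
`D` is stable; this forces the signs of `z` and `γ`. -/
theorem exists_supporting_functional (hconv : Convex ℝ D) (hclosed : IsClosed D)
    (hmono : ∀ x w t, (x, w, t) ∈ D → ∀ s ∈ S, ∀ τ : ℝ, 0 ≤ τ → (x, w + s, t + τ) ∈ D)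
    (hne : D.Nonempty) {a : X} {s : ℝ} (ha : (a, (0 : Z), s) ∉ D) :
    ∃ (x' : X →L[ℝ] ℝ) (z : Z →L[ℝ] ℝ) (γ c : ℝ), z ∈ posDual S ∧ 0 ≤ γ ∧
      (∀ x w t, (x, w, t) ∈ D → x' x - z w - γ * t ≤ c) ∧ c < x' a - γ * s := by
  obtain ⟨f, c, hD, hc⟩ := geometric_hahn_banach_closed_point hconv hclosed ha
  set x' : X →L[ℝ] ℝ := f.comp (.inl ℝ X (Z × ℝ)) with hx'
  set z : Z →L[ℝ] ℝ := -(f.comp ((ContinuousLinearMap.inr ℝ X (Z × ℝ)).comp (.inl ℝ Z ℝ))) with hz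
  set γ : ℝ := -f (0, 0, 1) with hγ
  have hf : ∀ x w t, f (x, w, t) = x' x - z w - γ * t := by
    intro x w t
    have : ((x, w, t) : X × Z × ℝ) = (x, 0, 0) + (0, w, 0) + t • (0, 0, 1) := by simp
    rw [this, map_add, map_add, map_smul]
    simp only [hx', hz, hγ, ContinuousLinearMap.comp_apply, ContinuousLinearMap.inl_apply,
      ContinuousLinearMap.inr_apply, neg_apply, smul_eq_mul, ← Prod.zero_eq_mk]
    ring
  obtain ⟨⟨x₀, w₀, t₀⟩, h₀⟩ := hne
  have nonneg_of_bdd : ∀ b e : ℝ, (∀ n : ℝ, 0 ≤ n → e - n * b < c) → 0 ≤ b := by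
    intro b e hbe
    by_contra! hb
    have h1 := hbe ((|c - e|) / (-b)) (div_nonneg (abs_nonneg _) (by linarith))
    have h2 : |c - e| / (-b) * b = -|c - e| := by
      rw [div_neg, neg_mul, div_mul_cancel₀ _ hb.ne]
    rw [h2] at h1
    linarith [le_abs_self (c - e)]
  refine ⟨x', z, γ, c, fun σ hσ => ?_, ?_, fun x w t h => ?_, ?_⟩
  · refine nonneg_of_bdd _ (x' x₀ - z w₀ - γ * t₀) fun n hn => ?_
    have := hD _ (hmono _ _ _ h₀ (n • σ) (S.smul_mem hσ hn) 0 le_rfl)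
    rw [hf] at this
    simp only [map_add, map_smul, smul_eq_mul, add_zero] at this
    linarith
  · refine nonneg_of_bdd _ (x' x₀ - z w₀ - γ * t₀) fun n hn => ?_
    have := hD _ (hmono _ _ _ h₀ 0 S.zero_mem n hn)
    rw [hf, add_zero] at this
    linarith
  · rw [← hf]
    exact (hD _ h).le
  · simpa [hf] using hc

/-- The functional separating `(a, 0, s)` may be vertical (`γ = 0`), but one separating `(a₀, 0,
t₁)` cannot be, as `(a₀, 0, t₀) ∈ D` differs from it only in the last coordinate. -/
theorem exists_nonvertical_supporting_functional (hconv : Convex ℝ D) (hclosed : IsClosed D)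
    (hmono : ∀ x w t, (x, w, t) ∈ D → ∀ s ∈ S, ∀ τ : ℝ, 0 ≤ τ → (x, w + s, t + τ) ∈ D)
    {a₀ : X} {t₀ t₁ : ℝ} (h₀ : (a₀, (0 : Z), t₀) ∈ D) (h₁ : (a₀, (0 : Z), t₁) ∉ D)
    {a : X} {s : ℝ} (ha : (a, (0 : Z), s) ∉ D) :
    ∃ (x' : X →L[ℝ] ℝ) (z : Z →L[ℝ] ℝ) (c : ℝ), z ∈ posDual S ∧
      (∀ x w t, (x, w, t) ∈ D → x' x - z w - t ≤ c) ∧ c < x' a - s := by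
  have normalize : ∀ {b : X} {r : ℝ} {x' : X →L[ℝ] ℝ} {z : Z →L[ℝ] ℝ} {γ c : ℝ},
      z ∈ posDual S → 0 < γ → (∀ x w t, (x, w, t) ∈ D → x' x - z w - γ * t ≤ c) →
      c < x' b - γ * r → ∃ (x' : X →L[ℝ] ℝ) (z : Z →L[ℝ] ℝ) (c : ℝ), z ∈ posDual S ∧
      (∀ x w t, (x, w, t) ∈ D → x' x - z w - t ≤ c) ∧ c < x' b - r := by
    intro b r x' z γ c hz hγ hD hc
    refine ⟨γ⁻¹ • x', γ⁻¹ • z, γ⁻¹ * c, fun σ hσ => ?_, fun x w t h => ?_, ?_⟩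
    · exact mul_nonneg (inv_nonneg.2 hγ.le) (hz σ hσ)
    · have := mul_le_mul_of_nonneg_left (hD x w t h) (inv_nonneg.2 hγ.le)
      rw [mul_sub, mul_sub, inv_mul_cancel_left₀ hγ.ne'] at this
      simpa using this
    · have := mul_lt_mul_of_pos_left hc (inv_pos.2 hγ)
      rw [mul_sub, inv_mul_cancel_left₀ hγ.ne'] at this
      simpa using this
  obtain ⟨x₁, z₁, c₁, hz₁, hD₁, -⟩ : ∃ (x' : X →L[ℝ] ℝ) (z : Z →L[ℝ] ℝ) (c : ℝ), z ∈ posDual S ∧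
      (∀ x w t, (x, w, t) ∈ D → x' x - z w - t ≤ c) ∧ c < x' a₀ - t₁ := by
    obtain ⟨x', z, γ, c, hz, hγ, hD, hc⟩ :=
      exists_supporting_functional hconv hclosed hmono ⟨_, h₀⟩ h₁
    refine normalize hz (lt_of_le_of_ne hγ fun h => ?_) hD hc
    have := hD _ _ _ h₀
    rw [← h, map_zero] at this
    rw [← h] at hc
    linarith
  obtain ⟨x', z, γ, c, hz, hγ, hD, hc⟩ :=
    exists_supporting_functional hconv hclosed hmono ⟨_, h₀⟩ ha
  -- Adding a large multiple of the separating functional to a nonvertical one separates.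
  obtain ⟨n, hn, hlt⟩ : ∃ n : ℝ, 0 ≤ n ∧
      c₁ - (x₁ a - s) < n * (x' a - γ * s - c) := by
    have hpos : 0 < x' a - γ * s - c := by linarith
    refine ⟨(|c₁ - (x₁ a - s)| + 1) / (x' a - γ * s - c), by positivity, ?_⟩
    rw [div_mul_cancel₀ _ hpos.ne']
    linarith [le_abs_self (c₁ - (x₁ a - s))]
  refine normalize (x' := x₁ + n • x') (z := z₁ + n • z) (γ := 1 + n * γ) (c := c₁ + n * c)
    (fun σ hσ => ?_) (by positivity) (fun x w t h => ?_) ?_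
  · exact add_nonneg (hz₁ σ hσ) (mul_nonneg hn (hz σ hσ))
  · have h1 := hD₁ x w t h
    have h2 := mul_le_mul_of_nonneg_left (hD x w t h) hn
    simp only [add_apply, smul_apply, smul_eq_mul]
    linarith
  · simp only [add_apply, smul_apply, smul_eq_mul]
    linarith

/-- A weak* approximate form of Farkas' lemma for a family of closed convex sets `D u`, the
epigraphs of perturbation functions: an affine minorant on the common section over `0` belongs to
the closed convex hull of the affine minorants obtained from multipliers. -/
theorem mem_closure_convexHull_multipliers {U : Type*} [Nonempty U] {D : U → Set (X × Z × ℝ)}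
    (hconv : ∀ u, Convex ℝ (D u)) (hclosed : ∀ u, IsClosed (D u))
    (hmono : ∀ u x w t, (x, w, t) ∈ D u → ∀ s ∈ S, ∀ τ : ℝ, 0 ≤ τ → (x, w + s, t + τ) ∈ D u)
    {a₀ : X} {t₀ t₁ : ℝ} (h₀ : ∀ u, (a₀, (0 : Z), t₀) ∈ D u) (h₁ : ∀ u, (a₀, (0 : Z), t₁) ∉ D u)
    {p : WeakBilin (dualPairing X)}
    (hp : ∀ a s, (∀ u, (a, (0 : Z), s) ∈ D u) → dualPairing X p (a, -1) ≤ s) :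
    p ∈ closure (convexHull ℝ {q : WeakBilin (dualPairing X) | ∃ z ∈ posDual S, ∃ u,
      ∀ x w t, (x, w, t) ∈ D u → dualPairing X q (x, -1) - z w - t ≤ 0}) := by
  set N := {q : WeakBilin (dualPairing X) | ∃ z ∈ posDual S, ∃ u,
      ∀ x w t, (x, w, t) ∈ D u → dualPairing X q (x, -1) - z w - t ≤ 0} with hN
  have sep : ∀ u (a : X) (s : ℝ), (a, (0 : Z), s) ∉ D u →
      ∃ q ∈ N, s < dualPairing X q (a, -1) := by
    intro u a s ha
    obtain ⟨x', z, c, hz, hD, hc⟩ := exists_nonvertical_supporting_functional (hconv u)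
      (hclosed u) (hmono u) (h₀ u) (h₁ u) ha
    refine ⟨(x', c), ⟨z, hz, u, fun x w t h => ?_⟩, ?_⟩
    · rw [dualPairing_apply]
      linarith [hD x w t h]
    · rw [dualPairing_apply]
      linarith
  -- Test points `(a, -1)` are settled by `sep` and `hp`; the rest reduces arbitrary `(a, β)` to
  -- them.
  have nonvertical : ∀ (a : X) (s : ℝ), (∀ q ∈ N, dualPairing X q (a, -1) ≤ s) →
      dualPairing X p (a, -1) ≤ s := by
    refine fun a s h => hp a s fun u => ?_
    by_contra hcon
    obtain ⟨q, hq, hlt⟩ := sep u a s hcon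
    exact absurd (h q hq) (not_le.2 hlt)
  refine mem_closure_convexHull_of_forall_dualPairing_le fun ⟨a, β⟩ s h => ?_
  -- `N` is stable under increasing its real component, so evaluation at `(a, β)` with `β > 0` is
  -- unbounded on `N`.
  have hβ : β ≤ 0 := by
    by_contra! hβ
    obtain ⟨⟨x', r⟩, ⟨z, hz, u, hq⟩, -⟩ := sep (Classical.arbitrary U) a₀ t₁ (h₁ _)
    have key : ∀ n : ℝ, 0 ≤ n → dualPairing X (x', r) (a, β) + n * β ≤ s := by
      intro n hn
      have := h (x', r + n) ⟨z, hz, u, fun x w t hx => ?_⟩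
      · rw [dualPairing_apply] at this ⊢
        linarith
      · have := hq x w t hx
        rw [dualPairing_apply] at this ⊢
        linarith
    have h1 := key ((|s - dualPairing X (x', r) (a, β)| + 1) / β) (by positivity)
    rw [div_mul_cancel₀ _ hβ.ne'] at h1
    linarith [le_abs_self (s - dualPairing X (x', r) (a, β))]
  rcases hβ.lt_or_eq with hβ | rfl
  · have hβ' : 0 < -β := by linarith
    have scale : ∀ q : WeakBilin (dualPairing X),
        dualPairing X q (a, β) = (-β) * dualPairing X q ((-β)⁻¹ • a, -1) := by
      intro q
      rw [← smul_eq_mul, ← map_smul, Prod.smul_mk, smul_inv_smul₀ hβ'.ne']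
      simp
    have := nonvertical ((-β)⁻¹ • a) ((-β)⁻¹ * s) fun q hq => by
      rw [le_inv_mul_iff₀ hβ', ← scale]
      exact h q hq
    rwa [le_inv_mul_iff₀ hβ', ← scale] at this
  -- For `β = 0`, apply `nonvertical` at `a₀ + n a`: elements of `N` are at most `t₀` at `(a₀, -1)`.
  -- Large `n` then isolates the value at `(a, 0)`.
  · have key : ∀ n : ℝ, 0 ≤ n →
        dualPairing X p (a₀, -1) + n * dualPairing X p (a, 0) ≤ t₀ + n * s := by
      intro n hn
      have split : ∀ q : WeakBilin (dualPairing X), dualPairing X q (a₀ + n • a, -1) =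
          dualPairing X q (a₀, -1) + n * dualPairing X q (a, 0) := by
        intro q
        rw [← smul_eq_mul, ← map_smul, ← map_add]
        simp
      rw [← split]
      refine nonvertical _ _ fun q hq => ?_
      rw [split]
      have hqa := mul_le_mul_of_nonneg_left (h q hq) hn
      obtain ⟨z, -, u, hq⟩ := hq
      have := hq _ _ _ (h₀ u)
      rw [map_zero] at this
      linarith
    by_contra! hcon
    have hpos : 0 < dualPairing X p (a, 0) - s := by linarith
    have := key ((|t₀ - dualPairing X p (a₀, -1)| + 1) / (dualPairing X p (a, 0) - s))
      (by positivity)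
    have h2 := div_mul_cancel₀ (|t₀ - dualPairing X p (a₀, -1)| + 1) hpos.ne'
    rw [mul_sub] at h2
    linarith [le_abs_self (t₀ - dualPairing X p (a₀, -1))]

end Separation

/-! ### Closedness and sectional convexity; embedding scalar data into a section. -/

section Closure

variable {X Y Z U : Type*}
  [AddCommGroup X] [Module ℝ X] [TopologicalSpace X]
  [AddCommGroup Y] [Module ℝ Y] [TopologicalSpace Y]
  [IsTopologicalAddGroup Y] [ContinuousSMul ℝ Y]
  [AddCommGroup Z] [Module ℝ Z] [TopologicalSpace Z]
  {K : ProperCone ℝ Y} {S : ProperCone ℝ Z} {C : Set X} {F : X → Ext Y}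
  {G : U → X → Ext Z} {k : Y}

/-- The pairs `(L, y)` for which `-y` is a weak lower bound of the perturbed primal problem, i.e.
the `K`-epigraph of the conjugate of `F + I_A` with `A` the feasible set. -/
def primalEpiConj (K : ProperCone ℝ Y) (S : ProperCone ℝ Z) (C : Set X) (F : X → Ext Y)
    (G : U → X → Ext Z) : Set ((X →Lₚₜ[ℝ] Y) × Y) :=
  {p | -p.2 ∉ strictUpper K (primalValues S C F G p.1)}

theorem mem_primalEpiConj {p : (X →Lₚₜ[ℝ] Y) × Y} :
    p ∈ primalEpiConj K S C F G ↔ ∀ x ∈ feasibleSet S C G, ∀ v, F x = Ext.fin v →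
      p.1 x - p.2 - v ∉ interior (K : Set Y) := by
  constructor
  · intro h x hx v hv hmem
    exact h ⟨_, ⟨x, hx, v, hv, rfl⟩, by convert hmem using 1; abel⟩
  · rintro h ⟨_, ⟨x, hx, v, hv, rfl⟩, hmem⟩
    exact h x hx v hv (by convert hmem using 1; abel)

theorem isClosed_primalEpiConj : IsClosed (primalEpiConj K S C F G) := by
  have : primalEpiConj K S C F G = ⋂ x ∈ feasibleSet S C G, ⋂ v, ⋂ _ : F x = Ext.fin v,
      (fun p : (X →Lₚₜ[ℝ] Y) × Y => p.1 x - p.2 - v) ⁻¹' (interior (K : Set Y))ᶜ := by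
    ext p
    simp [mem_primalEpiConj]
  rw [this]
  refine isClosed_biInter fun x _ => isClosed_iInter fun v => isClosed_iInter fun _ =>
    isOpen_interior.isClosed_compl.preimage ?_
  have : Continuous fun p : (X →Lₚₜ[ℝ] Y) × Y => p.1 x :=
    (PointwiseConvergenceCLM.evalCLM (RingHom.id ℝ) Y x).continuous.comp continuous_fst
  exact (this.sub continuous_snd).sub continuous_const

/-- The complement of `int K` is not convex in general, but within a section the values at a fixed
`x` differ by multiples of `k`, hence are totally ordered. If the combination were in `int K`, so
would be the larger endpoint. -/
theorem isSectionallyConvex_primalEpiConj (hk : k ∈ K) :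
    IsSectionallyConvex (sectionSpace X k) (primalEpiConj K S C F G) := by
  rintro v p ⟨hp, e₁, he₁, rfl⟩ q ⟨hq, e₂, he₂, rfl⟩ a b ha hb hab
  refine ⟨mem_primalEpiConj.2 fun x hx y hy hmem => ?_, a • e₁ + b • e₂,
    (sectionSpace X k).add_mem ((sectionSpace X k).smul_mem a he₁)
      ((sectionSpace X k).smul_mem b he₂), ?_⟩
  · have hp' := mem_primalEpiConj.1 hp x hx y hy
    have hq' := mem_primalEpiConj.1 hq x hx y hy
    obtain ⟨ξ₁, r₁, h₁, h₁'⟩ := he₁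
    obtain ⟨ξ₂, r₂, h₂, h₂'⟩ := he₂
    have h₁x := h₁ x
    have h₂x := h₂ x
    obtain rfl : b = 1 - a := by linarith
    simp only [Prod.fst_add, Prod.snd_add, Prod.smul_fst, Prod.smul_snd, add_apply, smul_apply,
      h₁x, h₂x, h₁', h₂', rankOne] at hmem hp' hq'
    rcases le_total ((ξ₂ x - r₂)) (ξ₁ x - r₁) with hle | hle
    · refine hp' ?_
      convert interior_add_mem hmem (K.smul_mem hk (mul_nonneg hb (sub_nonneg.2 hle))) using 1
      module
    · refine hq' ?_
      convert interior_add_mem hmem (K.smul_mem hk (mul_nonneg ha (sub_nonneg.2 hle))) using 1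
      module
  · obtain rfl : b = 1 - a := by linarith
    simp only
    module

variable [IsTopologicalAddGroup X] [ContinuousSMul ℝ X]

theorem mem_qualifyingSet (hF : ∀ x, F x ≠ Ext.bot) (hG : ∀ u x, G u x ≠ Ext.bot)
    (hne : ∃ x ∈ feasibleSet S C G, ∃ v, F x = Ext.fin v) (hk : k ∈ interior (K : Set Y))
    {L : X →Lₚₜ[ℝ] Y} {y : Y} :
    (L, y) ∈ qualifyingSet K S C F G k ↔
      ∃ z ∈ posDual S, ∃ u, -y ∉ strictUpper K (dualValues C F (G u) k L z) := by
  obtain ⟨x, hx, v, hv⟩ := hne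
  simp only [qualifyingSet, mem_iUnion, exists_prop]
  refine exists_congr fun z => and_congr_right fun _ => exists_congr fun u => ?_
  obtain ⟨s, -, hs⟩ := mem_iInter.1 hx.2 u
  exact mem_epiConj_lagrangian hF (hG u) ⟨x, hx.1, v, -s, hv, hs⟩ hk

theorem qualifyingSet_subset_primalEpiConj (hF : ∀ x, F x ≠ Ext.bot)
    (hG : ∀ u x, G u x ≠ Ext.bot) (hne : ∃ x ∈ feasibleSet S C G, ∃ v, F x = Ext.fin v)
    (hk : k ∈ interior (K : Set Y)) :
    qualifyingSet K S C F G k ⊆ primalEpiConj K S C F G := by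
  rintro ⟨L, y⟩ h
  obtain ⟨z, hz, u, hy⟩ := (mem_qualifyingSet hF hG hne hk).1 h
  exact fun hcon => hy (strictUpper_primalValues_subset (interior_subset hk) hz u hcon)

/-- The translation `(x', r) ↦ (L + k · (x' - x₀'), y + (r - r₀) k)` of a section. -/
noncomputable def sectionMap (k : Y) (L : X →Lₚₜ[ℝ] Y) (y : Y) (p q : (X →L[ℝ] ℝ) × ℝ) :
    (X →Lₚₜ[ℝ] Y) × Y :=
  (L + ContinuousLinearMap.toPointwiseConvergenceCLM ℝ (RingHom.id ℝ) X Y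
    ((q.1 - p.1).smulRight k), y + (q.2 - p.2) • k)

theorem sectionMap_fst_apply (L : X →Lₚₜ[ℝ] Y) (y : Y) (p q : (X →L[ℝ] ℝ) × ℝ) (x : X) :
    (sectionMap k L y p q).1 x = L x + (q.1 x - p.1 x) • k := rfl

theorem sectionMap_snd (L : X →Lₚₜ[ℝ] Y) (y : Y) (p q : (X →L[ℝ] ℝ) × ℝ) :
    (sectionMap k L y p q).2 = y + (q.2 - p.2) • k := rfl

theorem sectionMap_self (L : X →Lₚₜ[ℝ] Y) (y : Y) (p : (X →L[ℝ] ℝ) × ℝ) :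
    sectionMap k L y p p = (L, y) := by
  refine Prod.ext (DFunLike.ext _ _ fun x => ?_) ?_
  · rw [sectionMap_fst_apply]; simp
  · simp [sectionMap_snd]

/-- Both coordinates depend on `q` only through evaluations at `(x, 0)` and `(0, 1)`. -/
theorem continuous_sectionMap (L : X →Lₚₜ[ℝ] Y) (y : Y) (p : (X →L[ℝ] ℝ) × ℝ) :
    Continuous fun q : WeakBilin (dualPairing X) => sectionMap k L y p q := by
  have heval : ∀ a : X × ℝ, Continuous fun q : WeakBilin (dualPairing X) =>
      dualPairing X q a := WeakBilin.eval_continuous (dualPairing X)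
  refine Continuous.prodMk (PointwiseConvergenceCLM.continuous_of_continuous_eval fun x => ?_) ?_
  · have h : Continuous fun q : WeakBilin (dualPairing X) =>
        L x + (dualPairing X q (x, 0) - p.1 x) • k := by
      have := heval (x, 0)
      fun_prop
    refine h.congr fun ⟨ξ, r⟩ => ?_
    change L x + (ξ x + r * 0 - p.1 x) • k = _
    rw [mul_zero, add_zero]
    rfl
  · have h : Continuous fun q : WeakBilin (dualPairing X) =>
        y + (dualPairing X q (0, 1) - p.2) • k := by
      have := heval (0, 1)
      fun_prop
    refine h.congr fun ⟨ξ, r⟩ => ?_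
    change y + (ξ 0 + r * 1 - p.2) • k = _
    rw [map_zero, zero_add, mul_one]

/-- The map is affine with values in one section, so the preimage of a sectionally convex set is
convex. -/
theorem sectionMap_mem_sectionalHull {N : Set ((X →Lₚₜ[ℝ] Y) × Y)} {L : X →Lₚₜ[ℝ] Y} {y : Y}
    {p : (X →L[ℝ] ℝ) × ℝ} {Q : Set ((X →L[ℝ] ℝ) × ℝ)} (hQ : ∀ q ∈ Q, sectionMap k L y p q ∈ N)
    {q : (X →L[ℝ] ℝ) × ℝ} (hq : q ∈ convexHull ℝ Q) :
    sectionMap k L y p q ∈ sectionalHull (sectionSpace X k) N := by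
  rintro M ⟨hM, hNM⟩
  have hsection : ∀ q, sectionMap k L y p q ∈
      (fun e => e + (L, y)) '' (sectionSpace X k : Set ((X →Lₚₜ[ℝ] Y) × Y)) := by
    intro q
    refine ⟨sectionMap k 0 0 p q, ⟨q.1 - p.1, q.2 - p.2, fun x => ?_, ?_⟩, ?_⟩
    · rw [sectionMap_fst_apply]; simp [rankOne]
    · rw [sectionMap_snd, zero_add]
    · simp only [sectionMap, zero_add, Prod.mk_add_mk]
      rw [add_comm, add_comm _ y]
  have hconv : Convex ℝ {q | sectionMap k L y p q ∈ M} := by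
    intro q₁ h₁ q₂ h₂ a b ha hb hab
    have := (hM (L, y) ⟨h₁, hsection q₁⟩ ⟨h₂, hsection q₂⟩ ha hb hab).1
    obtain rfl : b = 1 - a := by linarith
    change sectionMap k L y p _ ∈ M
    convert this using 1
    refine Prod.ext (DFunLike.ext _ _ fun x => ?_) ?_
    · rw [Prod.fst_add, Prod.smul_fst, Prod.smul_fst]
      change _ = a • (sectionMap k L y p q₁).1 x + (1 - a) • (sectionMap k L y p q₂).1 x
      rw [sectionMap_fst_apply, sectionMap_fst_apply, sectionMap_fst_apply]
      change L x + (a * q₁.1 x + (1 - a) * q₂.1 x - p.1 x) • k = _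
      module
    · simp only [sectionMap_snd, Prod.snd_add, Prod.smul_snd, smul_eq_mul]
      module
  have hsub : Q ⊆ {q | sectionMap k L y p q ∈ M} := fun q hq => hNM (hQ q hq)
  have := convexHull_min hsub hconv hq
  exact this

end Closure

/-! ### Scalarization and the closed sectionally convex hull. -/

section Scalarization

variable {X Y Z U : Type*}
  [AddCommGroup X] [Module ℝ X] [TopologicalSpace X]
  [AddCommGroup Y] [Module ℝ Y] [TopologicalSpace Y]
  [AddCommGroup Z] [Module ℝ Z] [TopologicalSpace Z]
  {K : ProperCone ℝ Y} {S : ProperCone ℝ Z} {C : Set X} {F : X → Ext Y}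
  {G : U → X → Ext Z} {g : X → Ext Z} {k : Y}

theorem mk_fin_mem_epi {x : X} {v y : Y} (hv : F x = Ext.fin v) :
    (x, y) ∈ epi K F ↔ y - v ∈ K := by
  constructor
  · rintro ⟨c, hc, h⟩
    simp only [hv, Ext.fin_add_fin, Ext.fin.injEq] at h
    rw [h]
    simpa using hc
  · exact fun h => ⟨y - v, h, by simp [hv, Ext.fin_add_fin]⟩

theorem exists_eq_fin_of_mem_epi {x : X} {y : Y} (h : (x, y) ∈ epi K F) :
    ∃ v, F x = Ext.fin v ∧ y - v ∈ K := by
  obtain ⟨c, hc, h⟩ := h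
  rcases hv : F x with _ | v | _
  · simp [hv, Ext.bot_add_fin] at h
  · exact ⟨v, rfl, (mk_fin_mem_epi hv).1 ⟨c, hc, h⟩⟩
  · simp [hv, Ext.top_add] at h

theorem IsConeConvex.exists_fin_combo (hF : IsConeConvex K F) {x₁ x₂ : X} {v₁ v₂ : Y}
    (h₁ : F x₁ = Ext.fin v₁) (h₂ : F x₂ = Ext.fin v₂) {a b : ℝ} (ha : 0 ≤ a) (hb : 0 ≤ b)
    (hab : a + b = 1) :
    ∃ v, F (a • x₁ + b • x₂) = Ext.fin v ∧ a • v₁ + b • v₂ - v ∈ K := by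
  have mem : ∀ {x v}, F x = Ext.fin v → (x, v) ∈ epi K F := fun h =>
    (mk_fin_mem_epi h).2 (by rw [sub_self]; exact K.zero_mem)
  exact exists_eq_fin_of_mem_epi (hF (mem h₁) (mem h₂) ha hb hab)

/-- Feasibility becomes the slice `w = 0` of the constraint epigraphs, which is where the Farkas
lemma tests. -/
theorem mem_feasibleSet_iff {x : X} :
    x ∈ feasibleSet S C G ↔ x ∈ C ∧ ∀ u, (x, (0 : Z)) ∈ epi S (G u) := by
  simp only [feasibleSet, mem_inter_iff, mem_iInter, mem_ofPred_eq]
  refine and_congr_right fun _ => forall_congr' fun u => ?_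
  constructor
  · rintro ⟨s, hs, h⟩
    exact (mk_fin_mem_epi h).2 (by simpa using hs)
  · intro h
    obtain ⟨w, hw, hmem⟩ := exists_eq_fin_of_mem_epi h
    exact ⟨0 - w, hmem, by simp [hw]⟩

theorem ConvexData.convex_feasibleSet (h : ConvexData K S C F G) :
    Convex ℝ (feasibleSet S C G) := by
  intro x₁ h₁ x₂ h₂ a b ha hb hab
  rw [mem_feasibleSet_iff] at h₁ h₂ ⊢
  refine ⟨h.convex_set h₁.1 h₂.1 ha hb hab, fun u => ?_⟩
  simpa using h.convex_constraint u (h₁.2 u) (h₂.2 u) ha hb hab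

theorem scalarize_le_coe_iff {f : Y →L[ℝ] ℝ} {x : X} (hx : F x ≠ Ext.bot) {t : ℝ} :
    scalarize f F x ≤ (t : EReal) ↔ ∃ v, F x = Ext.fin v ∧ f v ≤ t := by
  unfold scalarize
  rcases hv : F x with _ | v | _
  · exact absurd hv hx
  · simp
  · simp

/-- The epigraph of the perturbation function `(x, w) ↦ f (F x)` restricted to `x ∈ C` and
`w ∈ g x + S`. -/
def perturbationEpi (S : ProperCone ℝ Z) (C : Set X) (F : X → Ext Y) (g : X → Ext Z)
    (f : Y →L[ℝ] ℝ) : Set (X × Z × ℝ) :=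
  {p | p.1 ∈ C ∧ (p.1, p.2.1) ∈ epi S g ∧ scalarize f F p.1 ≤ (p.2.2 : EReal)}

theorem isClosed_perturbationEpi {f : Y →L[ℝ] ℝ} (hC : IsClosed C) (hg : IsEpiClosed S g)
    (hf : LowerSemicontinuous (scalarize f F)) : IsClosed (perturbationEpi S C F g f) :=
  (hC.preimage continuous_fst).inter <|
    ((hg : IsClosed (epi S g)).preimage
      (continuous_fst.prodMk (continuous_fst.comp continuous_snd))).inter <|
    hf.isClosed_epigraph.preimage (continuous_fst.prodMk
      (continuous_coe_real_ereal.comp (continuous_snd.comp continuous_snd)))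

theorem convex_perturbationEpi {f : Y →L[ℝ] ℝ} (hf : f ∈ posDual K) (hC : Convex ℝ C)
    (hg : IsConeConvex S g) (hF : IsConeConvex K F) (hbot : ∀ x, F x ≠ Ext.bot) :
    Convex ℝ (perturbationEpi S C F g f) := by
  rintro p ⟨h₁, h₂, h₃⟩ q ⟨h₁', h₂', h₃'⟩ a b ha hb hab
  refine ⟨hC h₁ h₁' ha hb hab, hg h₂ h₂' ha hb hab, ?_⟩
  rw [scalarize_le_coe_iff (hbot _)] at h₃ h₃' ⊢
  obtain ⟨v, hv, hle⟩ := h₃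
  obtain ⟨v', hv', hle'⟩ := h₃'
  obtain ⟨y, hy, hmem⟩ := hF.exists_fin_combo hv hv' ha hb hab
  refine ⟨y, hy, ?_⟩
  have := hf _ hmem
  simp only [map_sub, map_add, map_smul, smul_eq_mul] at this
  simp only [Prod.snd_add, Prod.smul_snd, smul_eq_mul]
  nlinarith [mul_le_mul_of_nonneg_left hle ha, mul_le_mul_of_nonneg_left hle' hb]

variable [IsTopologicalAddGroup Y] [ContinuousSMul ℝ Y]

theorem ConvexData.convex_strictUpper_primalValues (h : ConvexData K S C F G)
    (L : X →Lₚₜ[ℝ] Y) : Convex ℝ (strictUpper K (primalValues S C F G L)) := by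
  rintro y₁ ⟨_, ⟨x₁, hx₁, v₁, hv₁, rfl⟩, h₁⟩ y₂ ⟨_, ⟨x₂, hx₂, v₂, hv₂, rfl⟩, h₂⟩ a b ha hb hab
  obtain ⟨v, hv, hmem⟩ := h.convex_obj.exists_fin_combo hv₁ hv₂ ha hb hab
  refine ⟨_, ⟨_, h.convex_feasibleSet hx₁ hx₂ ha hb hab, v, hv, rfl⟩, ?_⟩
  have hint := K.convex.interior h₁ h₂ ha hb hab
  convert interior_add_mem hint hmem using 1
  rw [map_add, map_smul, map_smul]
  module

/-- Scalarization of a weak lower bound. -/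
theorem ConvexData.exists_scalarization [LocallyConvexSpace ℝ Y] (h : ConvexData K S C F G)
    (hne : ∃ x ∈ feasibleSet S C G, ∃ v, F x = Ext.fin v) (hk : k ∈ interior (K : Set Y))
    {L : X →Lₚₜ[ℝ] Y} {y : Y} (hy : y ∉ strictUpper K (primalValues S C F G L)) :
    ∃ f ∈ posDual K, f k = 1 ∧ ∀ m ∈ primalValues S C F G L, f y ≤ f m := by
  obtain ⟨f, hf⟩ := geometric_hahn_banach_point_open (h.convex_strictUpper_primalValues L)
    (isOpen_strictUpper _) hy
  obtain ⟨x₀, hx₀, v₀, hv₀⟩ := hne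
  have hlt : ∀ m ∈ primalValues S C F G L, ∀ d ∈ interior (K : Set Y), f y < f m + f d := by
    intro m hm d hd
    rw [← map_add]
    exact hf _ ⟨m, hm, by simpa using hd⟩
  have hm₀ : v₀ - L x₀ ∈ primalValues S C F G L := ⟨x₀, hx₀, v₀, hv₀, rfl⟩
  -- A negative `f c` would be contradicted by the interior direction `k + n c` for large `n`.
  have hpos : f ∈ posDual K := by
    intro c hc
    by_contra! hcon
    have key : ∀ n : ℝ, 0 ≤ n → f y < f (v₀ - L x₀) + f k + n * f c := by
      intro n hn
      have := hlt _ hm₀ _ (interior_add_mem hk (K.smul_mem hc hn))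
      rw [map_add, map_smul, smul_eq_mul] at this
      linarith
    have h1 := key (|f (v₀ - L x₀) + f k - f y| / (-f c))
      (div_nonneg (abs_nonneg _) (by linarith))
    rw [div_neg, neg_mul, div_mul_cancel₀ _ hcon.ne] at h1
    linarith [le_abs_self (f (v₀ - L x₀) + f k - f y)]
  have hf0 : f ≠ 0 := by
    rintro rfl
    simpa using hlt _ hm₀ k hk
  have hfk : 0 < f k := pos_of_mem_interior hpos hf0 hk
  -- Use the direction `(ε / f k) k`, on which `f` equals `ε`.
  have hle : ∀ m ∈ primalValues S C F G L, f y ≤ f m := by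
    refine fun m hm => le_of_forall_pos_lt_add fun ε hε => ?_
    have := hlt m hm _ (smul_mem_interior hk (div_pos hε hfk))
    rwa [map_smul, smul_eq_mul, div_mul_cancel₀ _ hfk.ne'] at this
  refine ⟨(f k)⁻¹ • f, fun c hc => mul_nonneg (inv_nonneg.2 hfk.le) (hpos c hc),
    inv_mul_cancel₀ hfk.ne', fun m hm => ?_⟩
  exact mul_le_mul_of_nonneg_left (hle m hm) (inv_nonneg.2 hfk.le)

variable [IsTopologicalAddGroup X] [ContinuousSMul ℝ X] [LocallyConvexSpace ℝ X]
  [LocallyConvexSpace ℝ Y]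
  [IsTopologicalAddGroup Z] [ContinuousSMul ℝ Z] [LocallyConvexSpace ℝ Z] [Nonempty U]

/-- The pair `p = (f ∘ L, f y)` is a scalar minorant over the feasible set, hence a weak* limit of
convex combinations of minorants with multipliers. `sectionMap` sends `p` to `(L, y)` and each such
minorant into `qualifyingSet`. -/
theorem ConvexData.primalEpiConj_subset_closure (h : ConvexData K S C F G)
    (hF : ∀ x, F x ≠ Ext.bot) (hG : ∀ u x, G u x ≠ Ext.bot)
    (hne : ∃ x ∈ feasibleSet S C G, ∃ v, F x = Ext.fin v) (hk : k ∈ interior (K : Set Y)) :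
    primalEpiConj K S C F G ⊆
      closure (sectionalHull (sectionSpace X k) (qualifyingSet K S C F G k)) := by
  rintro ⟨L, y⟩ hLy
  obtain ⟨f, hf, hfk, hle⟩ := h.exists_scalarization hne hk hLy
  have hf0 : f ≠ 0 := by
    rintro rfl
    simp at hfk
  set D : U → Set (X × Z × ℝ) := fun u => perturbationEpi S C F (G u) f with hD
  set p : (X →L[ℝ] ℝ) × ℝ := (f.comp (L : X →L[ℝ] Y), f y) with hp
  have mem_D : ∀ {u : U} {x : X} {w : Z} {t : ℝ}, (x, w, t) ∈ D u ↔
      x ∈ C ∧ (x, w) ∈ epi S (G u) ∧ ∃ v, F x = Ext.fin v ∧ f v ≤ t := fun {u x w t} => by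
    rw [← scalarize_le_coe_iff (hF x)]
    rfl
  obtain ⟨x₀, hx₀, v₀, hv₀⟩ := id hne
  have hcl : (p : WeakBilin (dualPairing X)) ∈ closure (convexHull ℝ
      {q : WeakBilin (dualPairing X) | ∃ z ∈ posDual S, ∃ u,
        ∀ x w t, (x, w, t) ∈ D u → dualPairing X q (x, -1) - z w - t ≤ 0}) := by
    refine mem_closure_convexHull_multipliers (a₀ := x₀) (t₀ := f v₀) (t₁ := f v₀ - 1)
      (fun u => convex_perturbationEpi hf h.convex_set (h.convex_constraint u) h.convex_obj hF)
      (fun u => isClosed_perturbationEpi h.closed_set (h.closed_constraint u)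
        (h.lsc_obj f hf hf0)) ?_ ?_ ?_ ?_
    · intro u x w t hmem s hs τ hτ
      obtain ⟨hx, hw, v, hv, hvt⟩ := mem_D.1 hmem
      obtain ⟨w', hw', hsub⟩ := exists_eq_fin_of_mem_epi hw
      refine mem_D.2 ⟨hx, (mk_fin_mem_epi hw').2 ?_, v, hv, by linarith⟩
      rw [add_sub_right_comm]
      exact S.add_mem hsub hs
    · exact fun u => mem_D.2 ⟨hx₀.1, (mem_feasibleSet_iff.1 hx₀).2 u, v₀, hv₀, le_rfl⟩
    · intro u hmem
      obtain ⟨-, -, v, hv, hvt⟩ := mem_D.1 hmem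
      rw [hv₀, Ext.fin.injEq] at hv
      rw [hv] at hvt
      linarith
    · intro a s ha
      obtain ⟨haC, -, v, hv, hvs⟩ := mem_D.1 (ha (Classical.arbitrary U))
      have := hle (v - L a) ⟨a, mem_feasibleSet_iff.2
        ⟨haC, fun u => (mem_D.1 (ha u)).2.1⟩, v, hv, rfl⟩
      rw [map_neg, map_sub] at this
      change f (L a) + f y * (-1) ≤ s
      linarith
  have hmaps : MapsTo (fun q : WeakBilin (dualPairing X) => sectionMap k L y p q)
      (convexHull ℝ {q : WeakBilin (dualPairing X) | ∃ z ∈ posDual S, ∃ u,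
        ∀ x w t, (x, w, t) ∈ D u → dualPairing X q (x, -1) - z w - t ≤ 0})
      (sectionalHull (sectionSpace X k) (qualifyingSet K S C F G k)) := by
    refine fun q hq => sectionMap_mem_sectionalHull ?_ hq
    rintro ⟨ξ, r⟩ ⟨z, hz, u, hzu⟩
    refine (mem_qualifyingSet hF hG hne hk).2 ⟨z, hz, u, ?_⟩
    rintro ⟨_, ⟨x, hx, v, w, hv, hw, rfl⟩, hmem⟩
    have hpos := pos_of_mem_interior hf hf0 hmem
    have hbound := hzu x w (f v) (mem_D.2 ⟨hx,
      (mk_fin_mem_epi hw).2 (by rw [sub_self]; exact S.zero_mem), v, hv, le_rfl⟩)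
    change ξ x + r * (-1) - z w - f v ≤ 0 at hbound
    -- Since `f k = 1`, the terms `f y` and `f (L x)` cancel, leaving exactly the quantity that
    -- `hbound` makes nonpositive.
    change 0 < f (-(y + (r - f y) • k) - (v - (L x + (ξ x - f (L x)) • k) + z w • k)) at hpos
    simp only [map_sub, map_neg, map_add, map_smul, smul_eq_mul, hfk, mul_one] at hpos
    linarith
  have := map_mem_closure (continuous_sectionMap (k := k) L y p) hcl hmaps
  rwa [sectionMap_self] at this

theorem ConvexData.closure_sectionalHull_qualifyingSet (h : ConvexData K S C F G)
    (hF : ∀ x, F x ≠ Ext.bot) (hG : ∀ u x, G u x ≠ Ext.bot)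
    (hne : ∃ x ∈ feasibleSet S C G, ∃ v, F x = Ext.fin v) (hk : k ∈ interior (K : Set Y)) :
    closure (sectionalHull (sectionSpace X k) (qualifyingSet K S C F G k)) =
      primalEpiConj K S C F G := by
  have hsub : sectionalHull (sectionSpace X k) (qualifyingSet K S C F G k) ⊆
      primalEpiConj K S C F G := sInter_subset_of_mem
    ⟨isSectionallyConvex_primalEpiConj (interior_subset hk),
      qualifyingSet_subset_primalEpiConj hF hG hne hk⟩
  exact (closure_minimal hsub isClosed_primalEpiConj).antisymm
    (h.primalEpiConj_subset_closure hF hG hne hk)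

end Scalarization

/-! ### Strong duality at a fixed perturbation. -/

section Duality

variable {X Y Z U : Type*}
  [AddCommGroup X] [Module ℝ X] [TopologicalSpace X] [IsTopologicalAddGroup X] [ContinuousSMul ℝ X]
  [AddCommGroup Y] [Module ℝ Y] [TopologicalSpace Y]
  [IsTopologicalAddGroup Y] [ContinuousSMul ℝ Y]
  [AddCommGroup Z] [Module ℝ Z] [TopologicalSpace Z] [Nonempty U]
  {K : ProperCone ℝ Y} {S : ProperCone ℝ Z} {C : Set X} {F : X → Ext Y}
  {G : U → X → Ext Z} {k : Y}

theorem dualWMax_eq_primalWInf_iff (hF : ∀ x, F x ≠ Ext.bot) (hG : ∀ u x, G u x ≠ Ext.bot)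
    (hne : ∃ x ∈ feasibleSet S C G, ∃ v, F x = Ext.fin v) (hk : k ∈ interior (K : Set Y))
    (L : X →Lₚₜ[ℝ] Y) :
    dualWMax K S C F G k L = primalWInf K S C F G L ↔
      ∀ y, (L, y) ∈ primalEpiConj K S C F G → (L, y) ∈ qualifyingSet K S C F G k := by
  have : Nonempty (posDual S × U) := ⟨⟨0, fun _ _ => le_rfl⟩, Classical.arbitrary U⟩
  have hunion : (⋃ z ∈ posDual S, ⋃ u : U,
      WInf K ((fun x => F x - Ext.fin (L x) + compMap (rankOne k z) (G u) x) '' C)) =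
      ⋃ i : posDual S × U, WInf K
        ((fun x => F x - Ext.fin (L x) + compMap (rankOne k (i.1 : Z →L[ℝ] ℝ)) (G i.2) x) '' C) := by
    ext d
    simp only [mem_iUnion, Prod.exists, Subtype.exists, exists_prop]
  have hdual : ∀ i : posDual S × U, {m | Ext.fin m ∈
      (fun x => F x - Ext.fin (L x) + compMap (rankOne k (i.1 : Z →L[ℝ] ℝ)) (G i.2) x) '' C} =
      dualValues C F (G i.2) k L i.1 := fun i => setOf_fin_mem_dual_image hF (hG i.2)
  have hprimal := setOf_fin_mem_primal_image (S := S) (C := C) (G := G) (L := L) hF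
  obtain ⟨x, hx, v, hv⟩ := id hne
  have hne₀ : (primalValues S C F G L).Nonempty := ⟨_, x, hx, v, hv, rfl⟩
  have hneD : ∀ i : posDual S × U, (dualValues C F (G i.2) k L i.1).Nonempty := fun i => by
    obtain ⟨s, -, hs⟩ := mem_iInter.1 hx.2 i.2
    exact ⟨_, x, hx.1, v, -s, hv, hs, rfl⟩
  rw [dualWMax, primalWInf, hunion, wMax_iUnion_wInf_eq_wInf_iff hk
    (M := fun i : posDual S × U =>
      (fun x => F x - Ext.fin (L x) + compMap (rankOne k (i.1 : Z →L[ℝ] ℝ)) (G i.2) x) '' C)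
    (M₀ := (fun x => F x - Ext.fin (L x)) '' feasibleSet S C G)
    (fun i => by have := hneD i; rwa [← hdual i] at this)
    (fun i => bot_notMem_dual_image hF (hG i.2)) (by rwa [← hprimal] at hne₀)
    (bot_notMem_primal_image hF)
    (fun i => by
      rw [hprimal, hdual]
      exact strictUpper_primalValues_subset (interior_subset hk) i.1.2 i.2)]
  simp only [hprimal, hdual, mem_qualifyingSet hF hG hne hk]
  -- A pair `(L, y)` encodes the lower bound `-y`, so the quantified variable changes sign.
  rw [(Equiv.neg Y).forall_congr_left]
  refine forall_congr' fun y => imp_congr Iff.rfl ?_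
  simp only [Prod.exists, Subtype.exists, exists_prop]
  rfl

end Duality

end RobustVector

theorem theorem6p6 {X Y Z U : Type*}
    [AddCommGroup X] [Module ℝ X] [TopologicalSpace X] [IsTopologicalAddGroup X]
    [ContinuousSMul ℝ X] [LocallyConvexSpace ℝ X] [T2Space X]
    [AddCommGroup Y] [Module ℝ Y] [TopologicalSpace Y] [IsTopologicalAddGroup Y]
    [ContinuousSMul ℝ Y] [LocallyConvexSpace ℝ Y] [T2Space Y]
    [AddCommGroup Z] [Module ℝ Z] [TopologicalSpace Z] [IsTopologicalAddGroup Z]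
    [ContinuousSMul ℝ Z] [LocallyConvexSpace ℝ Z] [T2Space Z]
    [Nonempty U]
    (K : ProperCone ℝ Y) (hK : (K : Set Y) ≠ Set.univ)
    (S : ProperCone ℝ Z) (C : Set X) (F : X → RobustVector.Ext Y)
    (G : U → X → RobustVector.Ext Z)
    (hF : RobustVector.IsProper F) (hG : ∀ u, RobustVector.IsProper (G u))
    (hA : (RobustVector.feasibleSet S C G ∩ RobustVector.dom F).Nonempty)
    (h0 : RobustVector.ConvexData K S C F G)
    (V : Set (X →Lₚₜ[ℝ] Y)) (hV : V.Nonempty)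
    (k : Y) (hk : k ∈ interior (K : Set Y)) :
    RobustVector.IsSectionallyConvexClosedRegarding (RobustVector.sectionSpace X k)
        (RobustVector.qualifyingSet K S C F G k) (V ×ˢ Set.univ) ↔
      RobustVector.RobustStrongStableDuality K S C F G k V := by
  have hne : ∃ x ∈ RobustVector.feasibleSet S C G, ∃ v, F x = RobustVector.Ext.fin v := by
    obtain ⟨x, hx, hdom⟩ := hA
    rcases hv : F x with _ | v | _
    · exact absurd hv (hF.2 x)
    · exact ⟨x, hx, v, hv⟩
    · exact absurd hv hdom
  have hG' : ∀ u x, G u x ≠ RobustVector.Ext.bot := fun u => (hG u).2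
  have hsub := RobustVector.qualifyingSet_subset_primalEpiConj hF.2 hG' hne hk
  rw [RobustVector.IsSectionallyConvexClosedRegarding,
    h0.closure_sectionalHull_qualifyingSet hF.2 hG' hne hk]
  constructor
  · intro h L hL
    refine (RobustVector.dualWMax_eq_primalWInf_iff hF.2 hG' hne hk L).2 fun y hy => ?_
    exact (h.subset ⟨hy, hL, Set.mem_univ y⟩).1
  · intro h
    refine Set.Subset.antisymm ?_ (Set.inter_subset_inter_left _ hsub)
    rintro ⟨L, y⟩ ⟨hy, hL⟩
    exact ⟨(RobustVector.dualWMax_eq_primalWInf_iff hF.2 hG' hne hk L).1 (h L hL.1) y hy, hL⟩
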